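/- **Setting.** A sequence $(\Delta_n)_{n\ge1}$ of *Bourgain–Delbaen sets* is a sequence of pairwise disjoint finite sets, with $\Gamma_n=\bigcup_{j\le n}\Delta_j$, $\Gamma=\bigcup_n\Delta_n$ and $\mathrm{rk}(\gamma)=n$ for $\gamma\in\Delta_n$, such that $\Delta_n\ne\emptyset$ for $n\ge2$ and, for every $n\ge 1$, each $\gamma\in\Delta_{n+1}$ is either * of type 0: $\gamma=(n+1,\beta,b^*,f)$ with $\beta\in[0,1]$ and $b^*\in B_{\ell_1(\Gamma_n)}$, or * of type 1: $\gamma=(n+1,\alpha,k,\xi,\beta,b^*,f)$ with $\alpha,\beta\in[0,1]$, $1\le k\le n-1$, $\xi\in\Delta_k$ and $b^*\in B_{\ell_1(\Gamma_n\setminus\Gamma_k)}$, where $f$ is a free variable from a finite set, used only to distinguish elements. Let $(e^*_\gamma)$ be the unit vectors of $c_{00}(\Gamma)\subset\ell_1(\Gamma)$. Recursively in the rank put $d^*_\gamma=e^*_\gamma-c^*_\gamma$, where $c^*_\gamma=0$ for $\gamma\in\Delta_1$, $c^*_\gamma=\beta b^*$ for $\gamma$ of type 0, and $c^*_\gamma=\alpha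 e^*_\xi+\beta P^*_{(k,n]}b^*$ for $\gamma\in\Delta_{n+1}$ of type 1. Here $P^*_{A}$, for a set $A$ of ranks, is the projection $\sum_\gamma a_\gamma d^*_\gamma\mapsto\sum_{\mathrm{rk}(\gamma)\in A}a_\gamma d^*_\gamma$; $(d^*_\gamma)_{\gamma\in\Gamma}$ is a vector space basis of $c_{00}(\Gamma)$. Put $F^*_n=\mathrm{span}\{d^*_\gamma:\gamma\in\Delta_n\}$. For $x\in\ell_\infty(\Gamma_m)$ let $J_m x$ be the function $\gamma\mapsto\langle P^*_{[1,m]}e^*_\gamma,x\rangle$ on $\Gamma$, and let $R_m$ be the restriction to $\Gamma_m$. The *Bourgain–Delbaen space* $Y$ is the closure of $\bigcup_m J_m(\ell_\infty(\Gamma_m))$ in $\ell_\infty(\Gamma)$, and $F_m=(J_mR_m-J_{m-1}R_{m-1})(Y)$, with $J_0R_0=0$. The set of cuts of $\gamma$ is defined recursively by $\mathrm{cuts}(\gamma)=\mathrm{cuts}(\xi)\cup\{\mathrm{rk}(\gamma)\}$ if $\gamma$ is of type 1, and $\mathrm{cuts}(\gamma)=\{\mathrm{rk}(\gamma)\}$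 if $\gamma\in\Delta_1$ or $\gamma$ is of type 0. Finally let $\mathcal C=\{\mathrm{cuts}(\gamma):\gamma\in\Gamma\}\subset[\mathbb N]^{<\omega}$, where the set $[\mathbb N]^{<\omega}$ of finite subsets of $\mathbb N$ carries the topology inherited from $\{0,1\}^{\mathbb N}$. A sequence $(E_i)$ of finite dimensional subspaces (possibly $\{0\}$) of a Banach space $Z$ is an *FDD* of $Z$ if every $x\in Z$ has a unique norm convergent expansion $x=\sum_i x_i$ with $x_i\in E_i$. Its *decomposition constant* is the supremum of the norms of its partial sum projections. It is *shrinking* if $Z^*$ is the closed linear span of $\bigcup_i E_i^*$, where $E_i^*\subset Z^*$ is the set of functionals vanishing on $E_j$ for all $j\neq i$. **Corollary 3.8.** Let $\theta<1/2$, and suppose that $(\Delta_n)$ satisfies: for each $n\ge2$ and each $\gamma\in\Delta_n$, with $\beta$ and $b^*$ as above, either $\beta\le\theta$, or $b^*=e^*_\eta$ for some $\eta\in\Delta_m$, $k<m<n$, with $c^*_\eta=0$ (where $k=0$ if $\gamma$ is of type 0). Then: 1. $(F^*_n)$ is an FDD of $\ell_1(\Gamma)$ whose decomposition constant is at most $\max\big(1/(1-2\theta),2\big)$,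 and $(F_n)$ is an FDD of $Y$. 2. $\mathcal C$ is relatively compact in $[\mathbb N]^{<\omega}$ if and only if it contains no infinite strictly increasing chain. 3. If $\mathcal C$ is relatively compact in $[\mathbb N]^{<\omega}$ (in particular, if it is compact), then $(F_n)$ is shrinking, and $Y^*$ is isomorphic to $\ell_1$. -/

import Mathlib

open Filter Topology
open scoped ENNReal

universe u

/-! ### Finite dimensional decompositions -/

/-- `E 0, E 1, E 2, …` is a finite dimensional decomposition (FDD) of the normed space `Z`:
the `E i` are finite dimensional, and every `x` has exactly one expansion `x = ∑ xᵢ` with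
`xᵢ ∈ E i`, the series being norm convergent in the given order.  `E i = {0}` is allowed. -/
def IsFDD {Z : Type*} [NormedAddCommGroup Z] [NormedSpace ℝ Z] (E : ℕ → Submodule ℝ Z) : Prop :=
  (∀ i, FiniteDimensional ℝ (E i)) ∧
    ∀ x : Z, ∃! s : ℕ → Z, (∀ i, s i ∈ E i) ∧
      Tendsto (fun n => ∑ i ∈ Finset.range n, s i) atTop (𝓝 x)

/-- The decomposition constant of `(E i)`, that is, the supremum of the norms of the partial sum
projections on the span of the `E i`, is at most `M`. -/
def DecompositionConstantLE {Z : Type*} [NormedAddCommGroup Z] [NormedSpace ℝ Z]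
    (E : ℕ → Submodule ℝ Z) (M : ℝ) : Prop :=
  ∀ s : ℕ → Z, (∀ i, s i ∈ E i) → ∀ n N : ℕ, n ≤ N →
    ‖∑ i ∈ Finset.range n, s i‖ ≤ M * ‖∑ i ∈ Finset.range N, s i‖

/-- The copy of the dual of `E i` inside the dual of `Z`: the functionals vanishing on all the
other summands, i.e. those which factor through the `i`-th coordinate projection. -/
def dualSummand {Z : Type*} [NormedAddCommGroup Z] [NormedSpace ℝ Z]
    (E : ℕ → Submodule ℝ Z) (i : ℕ) : Submodule ℝ (StrongDual ℝ Z) where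
  carrier := {f | ∀ j, j ≠ i → ∀ x ∈ E j, f x = 0}
  add_mem' := by
    intro f g hf hg j hj x hx
    simp [hf j hj x hx, hg j hj x hx]
  zero_mem' := by
    intro j hj x hx
    simp
  smul_mem' := by
    intro r f hf j hj x hx
    simp [hf j hj x hx]

/-- `(E i)` is a shrinking FDD of `Z`: it is an FDD, and the closed linear span of the dual
summands is the whole dual of `Z`. -/
def IsShrinkingFDD {Z : Type*} [NormedAddCommGroup Z] [NormedSpace ℝ Z]
    (E : ℕ → Submodule ℝ Z) : Prop :=
  IsFDD E ∧ (⨆ i, dualSummand E i).topologicalClosure = ⊤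

/-! ### Families of finite subsets of `ℕ` -/

/-- `[ℕ]^{<ω}`, the finite subsets of `ℕ`, as a subspace of `{0,1}^ℕ` with the product topology
(the pointwise topology). -/
abbrev FinSubsets : Type := {x : ℕ → Bool // {n | x n = true}.Finite}

/-- A finite set regarded as a point of `[ℕ]^{<ω}`, through its indicator function. -/
def FinSubsets.of (A : Finset ℕ) : FinSubsets :=
  ⟨fun n => decide (n ∈ A), A.finite_toSet.subset (by intro n hn; simpa using hn)⟩

/-- The family `C` contains an infinite strictly increasing chain. -/
def HasInfiniteIncreasingChain (C : Set (Finset ℕ)) : Prop :=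
  ∃ A : ℕ → Finset ℕ, StrictMono A ∧ ∀ i, A i ∈ C

/-! ### Bourgain-Delbaen sets -/

/-- The data carried by an element `γ` of `Γ = ⋃ Δₙ`, apart from its rank and its free variable:
* `initial` for the elements of `Δ₁`;
* `zero β b` for an element `(n, β, b, f)` of type 0;
* `one α ξ β b` for an element `(n, α, k, ξ, β, b, f)` of type 1, where `k` is the rank of `ξ`. -/
inductive BDLabel (Γ : Type u) : Type u
  | initial : BDLabel Γ
  | zero (β : ℝ) (b : Γ →₀ ℝ) : BDLabel Γ
  | one (α : ℝ) (ξ : Γ) (β : ℝ) (b : Γ →₀ ℝ) : BDLabel Γ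

/-- The `ℓ₁`-norm of a finitely supported vector. -/
noncomputable def l1norm {Γ : Type u} (b : Γ →₀ ℝ) : ℝ := b.sum fun _ r => |r|

/-- A sequence of Bourgain-Delbaen sets.  `Γ` is the disjoint union of the sets
`Δₙ = {γ | rk γ = n}`, `n ≥ 1`, and `Γₙ = {γ | rk γ ≤ n}`.  Vectors of `ℓ₁(Γₙ)` are finitely
supported functions on `Γ`.  Distinct elements may carry the same rank and label; this is the role
of the free variable, which ranges over arbitrary finite sets and has no other effect. -/
structure BourgainDelbaenSets (Γ : Type u) where
  /-- The rank. -/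
  rk : Γ → ℕ
  /-- The data carried by an element. -/
  label : Γ → BDLabel Γ
  one_le_rk : ∀ γ, 1 ≤ rk γ
  /-- Each `Δₙ` is finite. -/
  finite_rk : ∀ n, {γ | rk γ = n}.Finite
  /-- `Δₙ` is nonempty for `n ≥ 2`. -/
  exists_rk : ∀ n, 2 ≤ n → ∃ γ, rk γ = n
  /-- Exactly the elements of `Δ₁` carry no data. -/
  initial_iff : ∀ γ, label γ = BDLabel.initial ↔ rk γ = 1
  /-- For `γ = (n + 1, β, b, f)`: `β ∈ [0,1]` and `b` is in the unit ball of `ℓ₁(Γₙ)`. -/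
  zero_spec : ∀ γ β b, label γ = BDLabel.zero β b →
    (0 ≤ β ∧ β ≤ 1) ∧ (∀ η ∈ b.support, rk η < rk γ) ∧ l1norm b ≤ 1
  /-- For `γ = (n + 1, α, k, ξ, β, b, f)`: `α, β ∈ [0,1]`, `ξ ∈ Δₖ` with `1 ≤ k ≤ n - 1`, and `b` is
  in the unit ball of `ℓ₁(Γₙ \ Γₖ)`. -/
  one_spec : ∀ γ α ξ β b, label γ = BDLabel.one α ξ β b →
    (0 ≤ α ∧ α ≤ 1) ∧ (0 ≤ β ∧ β ≤ 1) ∧ rk ξ + 2 ≤ rk γ ∧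
      (∀ η ∈ b.support, rk ξ < rk η ∧ rk η < rk γ) ∧ l1norm b ≤ 1

namespace BourgainDelbaenSets

variable {Γ : Type u} (D : BourgainDelbaenSets Γ)

/-! ### The functionals `c*`, `d*` and the projections `P*` -/

/-- Auxiliary recursion: the vector `P*_{[1,m]} e*_γ`.  It serves only to define `c*` below;
`c_eq_zero_of_initial`, `c_eq_of_zero`, `c_eq_of_one` state the defining recursion of `c*`
in terms of the projections belonging to the basis `d*`. -/
noncomputable def initProj (m : ℕ) (γ : Γ) : Γ →₀ ℝ :=
  if D.rk γ ≤ m then Finsupp.single γ 1 else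
    match h : D.label γ with
    | .initial => 0
    | .zero β b => β • ∑ η ∈ b.support.attach, b η.1 • initProj m η.1
    | .one α ξ β b => α • initProj m ξ +
        β • ∑ η ∈ b.support.attach, b η.1 • (initProj m η.1 - initProj (min m (D.rk ξ)) η.1)
termination_by D.rk γ
decreasing_by
  · exact (D.zero_spec γ β b h).2.1 _ η.2
  · have := (D.one_spec γ α ξ β b h).2.2.1
    omega
  · exact ((D.one_spec γ α ξ β b h).2.2.2.1 _ η.2).2
  · exact ((D.one_spec γ α ξ β b h).2.2.2.1 _ η.2).2

/-- The functionals `c*_γ`, as vectors of `c₀₀(Γ)` (see the lemmas `c_eq_…` below). -/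
noncomputable def c (γ : Γ) : Γ →₀ ℝ :=
  match D.label γ with
  | .initial => 0
  | .zero β b => β • b
  | .one α ξ β b => α • Finsupp.single ξ 1 + β • (b - ∑ η ∈ b.support, b η • D.initProj (D.rk ξ) η)

/-- The functionals `d*_γ = e*_γ - c*_γ`. -/
noncomputable def d (γ : Γ) : Γ →₀ ℝ := Finsupp.single γ 1 - D.c γ

theorem initProj_support (γ : Γ) :
    ∀ (m : ℕ), ∀ η ∈ (D.initProj m γ).support, D.rk η ≤ m := by
  induction hn : D.rk γ using Nat.strong_induction_on generalizing γ with
  | _ n ih =>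
    subst hn
    intro m
    suffices h : D.initProj m γ ∈ Finsupp.supported ℝ ℝ {η | D.rk η ≤ m} by
      intro η hη
      exact h hη
    have key : ∀ η, D.rk η < D.rk γ → ∀ m', m' ≤ m →
        D.initProj m' η ∈ Finsupp.supported ℝ ℝ {η | D.rk η ≤ m} := by
      intro η hη m' hm' x hx
      exact (ih _ hη η rfl m' x hx).trans hm'
    rw [initProj]
    split_ifs with h
    · exact Finsupp.single_mem_supported ℝ _ h
    · split
      · exact Submodule.zero_mem _
      · rename_i β b hl
        exact Submodule.smul_mem _ _ (Submodule.sum_mem _ fun η _ => Submodule.smul_mem _ _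
          (key _ ((D.zero_spec γ β b hl).2.1 _ η.2) m le_rfl))
      · rename_i α ξ β b hl
        have hs := D.one_spec γ α ξ β b hl
        refine Submodule.add_mem _ (Submodule.smul_mem _ _ (key ξ (by omega) m le_rfl))
          (Submodule.smul_mem _ _ (Submodule.sum_mem _ fun η _ => Submodule.smul_mem _ _
            (Submodule.sub_mem _ (key _ (hs.2.2.2.1 _ η.2).2 m le_rfl)
              (key _ (hs.2.2.2.1 _ η.2).2 _ (min_le_left _ _)))))

/-- `c*_γ ∈ ℓ₁(Γₙ)` if `γ ∈ Δ_{n+1}`. -/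
theorem c_support (γ : Γ) : ∀ η ∈ (D.c γ).support, D.rk η < D.rk γ := by
  suffices h : D.c γ ∈ Finsupp.supported ℝ ℝ {η | D.rk η < D.rk γ} by
    intro η hη
    exact h hη
  rw [c]
  split
  · exact Submodule.zero_mem _
  · rename_i β b hl
    exact Submodule.smul_mem _ _ (fun η hη => (D.zero_spec γ β b hl).2.1 η hη)
  · rename_i α ξ β b hl
    have hs := D.one_spec γ α ξ β b hl
    have hξ : D.rk ξ < D.rk γ := by omega
    refine Submodule.add_mem _ (Submodule.smul_mem _ _ (Finsupp.single_mem_supported ℝ _ hξ))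
      (Submodule.smul_mem _ _ (Submodule.sub_mem _ (fun η hη => (hs.2.2.2.1 η hη).2)
        (Submodule.sum_mem _ fun η _ => Submodule.smul_mem _ _ fun x hx => ?_)))
    exact (D.initProj_support η _ x hx).trans_lt hξ

theorem single_mem_span_d (γ : Γ) :
    Finsupp.single γ (1 : ℝ) ∈ Submodule.span ℝ (D.d '' {η | D.rk η ≤ D.rk γ}) := by
  induction hn : D.rk γ using Nat.strong_induction_on generalizing γ with
  | _ n ih =>
    subst hn
    have h1 : Finsupp.single γ (1 : ℝ) = D.d γ + D.c γ := by simp [d]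
    rw [h1]
    refine Submodule.add_mem _ (Submodule.subset_span ⟨γ, le_refl (D.rk γ), rfl⟩) ?_
    rw [← Finsupp.sum_single (D.c γ)]
    refine Submodule.sum_mem _ fun η hη => ?_
    have hlt := D.c_support γ η hη
    have h2 := ih _ hlt η rfl
    have h3 : Finsupp.single η (D.c γ η) = (D.c γ η) • Finsupp.single η (1 : ℝ) := by simp
    change Finsupp.single η (D.c γ η) ∈ _
    rw [h3]
    refine Submodule.smul_mem _ _ (Submodule.span_mono (Set.image_mono ?_) h2)
    intro x hx
    exact le_trans hx hlt.le

theorem linearCombination_d_bijective :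
    Function.Bijective (Finsupp.linearCombination ℝ D.d) := by
  constructor
  · rw [← LinearMap.ker_eq_bot, LinearMap.ker_eq_bot']
    intro a ha
    by_contra hne
    obtain ⟨γ, hγ, hmax⟩ := Finset.exists_max_image a.support D.rk
      (Finsupp.support_nonempty_iff.mpr hne)
    have h0 := DFunLike.congr_fun ha γ
    rw [Finsupp.linearCombination_apply, Finsupp.sum, Finsupp.finsetSum_apply,
      Finset.sum_eq_single γ] at h0
    · have hc : D.c γ γ = 0 := by
        by_contra h
        exact lt_irrefl _ (D.c_support γ γ (Finsupp.mem_support_iff.mpr h))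
      simp [d, hc] at h0
      exact (Finsupp.mem_support_iff.mp hγ) h0
    · intro η hη hne'
      have hc : D.c η γ = 0 := by
        by_contra h
        exact absurd (D.c_support η γ (Finsupp.mem_support_iff.mpr h)) (not_lt.mpr (hmax η hη))
      simp [d, hc, hne']
    · intro h
      exact absurd hγ h
  · rw [← LinearMap.range_eq_top, Finsupp.range_linearCombination, eq_top_iff]
    intro b _
    rw [← Finsupp.sum_single b]
    refine Submodule.sum_mem _ fun η _ => ?_
    have h3 : Finsupp.single η (b η) = (b η) • Finsupp.single η (1 : ℝ) := by simp
    change Finsupp.single η (b η) ∈ _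
    rw [h3]
    exact Submodule.smul_mem _ _ (Submodule.span_mono (Set.image_subset_range _ _)
      (D.single_mem_span_d η))

/-- The vectors `d*_γ` form a vector space basis of `c₀₀(Γ)`. -/
noncomputable def dBasis : Module.Basis Γ ℝ (Γ →₀ ℝ) :=
  Module.Basis.ofRepr
    (LinearEquiv.ofBijective (Finsupp.linearCombination ℝ D.d) D.linearCombination_d_bijective).symm

@[simp]
theorem dBasis_apply (γ : Γ) : D.dBasis γ = D.d γ := by
  simp [dBasis]

open Classical in
/-- The projection `P*_A : ∑ a_γ d*_γ ↦ ∑_{rk γ ∈ A} a_γ d*_γ` on `c₀₀(Γ)`. -/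
noncomputable def projStar (A : Set ℕ) : (Γ →₀ ℝ) →ₗ[ℝ] (Γ →₀ ℝ) :=
  D.dBasis.constr ℝ fun γ => if D.rk γ ∈ A then D.d γ else 0

open Classical in
theorem projStar_d (A : Set ℕ) (γ : Γ) :
    D.projStar A (D.d γ) = if D.rk γ ∈ A then D.d γ else 0 := by
  rw [projStar, ← dBasis_apply, Module.Basis.constr_basis, dBasis_apply]

theorem projStar_projStar (A B : Set ℕ) (b : Γ →₀ ℝ) :
    D.projStar A (D.projStar B b) = D.projStar (A ∩ B) b := by
  classical
  have : (D.projStar A).comp (D.projStar B) = D.projStar (A ∩ B) := by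
    refine D.dBasis.ext fun γ => ?_
    by_cases hA : D.rk γ ∈ A <;> by_cases hB : D.rk γ ∈ B <;> simp [projStar_d, hA, hB]
  exact LinearMap.congr_fun this b

theorem projStar_single_of_le {m : ℕ} {γ : Γ} (h : D.rk γ ≤ m) :
    D.projStar (Set.Iic m) (Finsupp.single γ 1) = Finsupp.single γ 1 := by
  have : Submodule.span ℝ (D.d '' {η | D.rk η ≤ D.rk γ}) ≤
      LinearMap.eqLocus (D.projStar (Set.Iic m)) LinearMap.id := by
    rw [Submodule.span_le]
    rintro _ ⟨η, hη, rfl⟩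
    have : D.rk η ≤ m := le_trans hη h
    simp [projStar_d, this]
  exact this (D.single_mem_span_d γ)

theorem projStar_eq_sum (A : Set ℕ) (b : Γ →₀ ℝ) :
    D.projStar A b = ∑ η ∈ b.support, b η • D.projStar A (Finsupp.single η 1) := by
  conv_lhs => rw [← Finsupp.sum_single b, Finsupp.sum, map_sum]
  refine Finset.sum_congr rfl fun η _ => ?_
  rw [← map_smul]
  simp

theorem projStar_single_eq_initProj (γ : Γ) :
    ∀ m : ℕ, D.projStar (Set.Iic m) (Finsupp.single γ 1) = D.initProj m γ := by
  induction hn : D.rk γ using Nat.strong_induction_on generalizing γ with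
  | _ n ih =>
    subst hn
    intro m
    rw [initProj]
    split_ifs with h
    · exact D.projStar_single_of_le h
    · have h1 : Finsupp.single γ (1 : ℝ) = D.d γ + D.c γ := by simp [d]
      have h2 : D.projStar (Set.Iic m) (D.d γ) = 0 := by
        rw [projStar_d, if_neg]
        simpa using h
      rw [h1, map_add, h2, zero_add]
      split
      · rename_i hl
        simp [c, hl]
      · rename_i β b hl
        have hs := D.zero_spec γ β b hl
        have hc : D.c γ = β • b := by simp [c, hl]
        rw [hc, map_smul, projStar_eq_sum, ← Finset.sum_attach]
        congr 1
        refine Finset.sum_congr rfl fun η _ => ?_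
        rw [ih _ (hs.2.1 _ η.2) η.1 rfl]
      · rename_i α ξ β b hl
        have hs := D.one_spec γ α ξ β b hl
        have hc : D.c γ = α • Finsupp.single ξ 1 + β • (b - D.projStar (Set.Iic (D.rk ξ)) b) := by
          have : D.projStar (Set.Iic (D.rk ξ)) b =
              ∑ η ∈ b.support, b η • D.initProj (D.rk ξ) η := by
            rw [projStar_eq_sum]
            exact Finset.sum_congr rfl fun η hη => by rw [ih _ (hs.2.2.2.1 _ hη).2 η rfl]
          rw [this]
          simp [c, hl]
        rw [hc, map_add, map_smul, map_smul, map_sub, projStar_projStar, Set.Iic_inter_Iic,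
          ih _ (by omega) ξ rfl, projStar_eq_sum, D.projStar_eq_sum _ b, ← Finset.sum_sub_distrib,
          ← Finset.sum_attach]
        congr 2
        refine Finset.sum_congr rfl fun η _ => ?_
        rw [← smul_sub, ih _ (hs.2.2.2.1 _ η.2).2 η.1 rfl, ih _ (hs.2.2.2.1 _ η.2).2 η.1 rfl]

/-- `c*_γ = 0` for `γ ∈ Δ₁`. -/
theorem c_eq_zero_of_initial {γ : Γ} (h : D.label γ = .initial) : D.c γ = 0 := by
  simp [c, h]

/-- `c*_γ = β b*` for `γ` of type 0. -/
theorem c_eq_of_zero {γ : Γ} {β : ℝ} {b : Γ →₀ ℝ} (h : D.label γ = .zero β b) :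
    D.c γ = β • b := by
  simp [c, h]

/-- `c*_γ = α e*_ξ + β P*_{(k,n]} b*` for `γ` of type 1 and rank `n + 1`, where `k = rk ξ`. -/
theorem c_eq_of_one {γ : Γ} {α : ℝ} {ξ : Γ} {β : ℝ} {b : Γ →₀ ℝ}
    (h : D.label γ = .one α ξ β b) :
    D.c γ = α • Finsupp.single ξ 1 +
      β • D.projStar (Set.Ioc (D.rk ξ) (D.rk γ - 1)) b := by
  classical
  have hs := D.one_spec γ α ξ β b h
  have h1 : D.projStar (Set.Iic (D.rk γ - 1)) b = b := by
    rw [projStar_eq_sum]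
    conv_rhs => rw [← Finsupp.sum_single b, Finsupp.sum]
    refine Finset.sum_congr rfl fun η hη => ?_
    have := (hs.2.2.2.1 η hη).2
    rw [D.projStar_single_of_le (by omega)]
    simp
  have h2 : D.projStar (Set.Ioc (D.rk ξ) (D.rk γ - 1)) =
      D.projStar (Set.Iic (D.rk γ - 1)) - D.projStar (Set.Iic (D.rk ξ)) := by
    refine D.dBasis.ext fun η => ?_
    simp only [dBasis_apply, projStar_d, LinearMap.sub_apply, Set.mem_Ioc, Set.mem_Iic]
    by_cases hA : D.rk η ≤ D.rk ξ
    · have h3 : D.rk η ≤ D.rk γ - 1 := by omega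
      have h4 : ¬ D.rk ξ < D.rk η := by omega
      simp [hA, h3, h4]
    · have h4 : D.rk ξ < D.rk η := by omega
      simp [hA, h4]
  rw [h2, LinearMap.sub_apply, h1, D.projStar_eq_sum (Set.Iic (D.rk ξ)) b]
  simp [c, h, projStar_single_eq_initProj]

/-! ### The condition on the weights, and the cuts -/

/-- For each `γ`, of rank `n` and with weight `β` and functional `b*`, either `β ≤ θ`, or
`b* = e*_η` for some `η ∈ Δₘ`, `k < m < n`, with `c*_η = 0`.  Here `k = rk ξ` if `γ` is of type 1,
and `k = 0` if `γ` is of type 0. -/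
def WeightCondition (θ : ℝ) : Prop :=
  (∀ γ β b, D.label γ = .zero β b →
    β ≤ θ ∨ ∃ η, D.rk η < D.rk γ ∧ b = Finsupp.single η 1 ∧ D.c η = 0) ∧
  (∀ γ α ξ β b, D.label γ = .one α ξ β b →
    β ≤ θ ∨ ∃ η, D.rk ξ < D.rk η ∧ D.rk η < D.rk γ ∧ b = Finsupp.single η 1 ∧ D.c η = 0)

/-- The set of cuts of `γ`: the ranks `p₁ < … < p_a = rk γ` of the elements met when one passes
repeatedly from an element of type 1 to its `ξ`, until an element of type 0 or of `Δ₁` is met. -/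
def cuts (γ : Γ) : Finset ℕ :=
  match h : D.label γ with
  | .initial => {D.rk γ}
  | .zero _ _ => {D.rk γ}
  | .one _ ξ _ _ => insert (D.rk γ) (cuts ξ)
termination_by D.rk γ
decreasing_by
  have := (D.one_spec γ _ ξ _ _ h).2.2.1
  omega

/-- The family of the cut sets of all `γ ∈ Γ`. -/
def cutFamily : Set (Finset ℕ) := Set.range D.cuts

/-! ### The FDD of `ℓ₁(Γ)` -/

/-- A finitely supported vector regarded as an element of `ℓ₁(Γ)`. -/
noncomputable def toL1 (b : Γ →₀ ℝ) : lp (fun _ : Γ => ℝ) 1 :=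
  ⟨fun γ => b γ, memℓp_gen (summable_of_hasFiniteSupport (b.hasFiniteSupport.subset (by
    intro γ hγ
    by_contra h
    simp at h
    simp [h] at hγ)))⟩

/-- `F*ₙ = span {d*_γ | γ ∈ Δₙ}`, as a subspace of `ℓ₁(Γ)`. -/
noncomputable def Fstar (n : ℕ) : Submodule ℝ (lp (fun _ : Γ => ℝ) 1) :=
  Submodule.span ℝ ((fun γ => toL1 (D.d γ)) '' {γ | D.rk γ = n})

/-! ### The Bourgain-Delbaen space and its FDD -/

/-- The duality between `c₀₀(Γ) ⊆ ℓ₁(Γ)` and functions on `Γ`. -/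
noncomputable def pairing (b : Γ →₀ ℝ) (x : Γ → ℝ) : ℝ := b.sum fun γ r => r * x γ

/-- `Jₘ x`, i.e. the function `γ ↦ ⟨P*_{[1,m]} e*_γ, x⟩` on `Γ`.  As `P*_{[1,m]} e*_γ` lives on `Γₘ`,
this depends only on the restriction of `x` to `Γₘ`, so that it is the extension operator `Jₘ`
applied to `x|_{Γₘ}`, and `Jₘ ∘ Rₘ` applied to `x`. -/
noncomputable def J (m : ℕ) (x : Γ → ℝ) (γ : Γ) : ℝ :=
  pairing (D.projStar (Set.Iic m) (Finsupp.single γ 1)) x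

theorem pairing_add (b : Γ →₀ ℝ) (x y : Γ → ℝ) :
    pairing b (x + y) = pairing b x + pairing b y := by
  simp [pairing, Finsupp.sum, mul_add, Finset.sum_add_distrib]

theorem pairing_smul (b : Γ →₀ ℝ) (r : ℝ) (x : Γ → ℝ) :
    pairing b (r • x) = r * pairing b x := by
  simp only [pairing, Finsupp.sum, Pi.smul_apply, smul_eq_mul, Finset.mul_sum]
  exact Finset.sum_congr rfl fun _ _ => by ring

/-- `Jₘ x` depends only on the values of `x` on `Γₘ`. -/
theorem J_congr {m : ℕ} {x y : Γ → ℝ} (h : ∀ γ, D.rk γ ≤ m → x γ = y γ) : D.J m x = D.J m y := by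
  funext γ
  rw [J, J, projStar_single_eq_initProj, pairing, pairing, Finsupp.sum, Finsupp.sum]
  exact Finset.sum_congr rfl fun η hη => by rw [h η (D.initProj_support γ m η hη)]

/-- `Yₘ = Jₘ(ℓ_∞(Γₘ))`, a subspace of `ℓ_∞(Γ)`. -/
noncomputable def Ym (m : ℕ) : Submodule ℝ (lp (fun _ : Γ => ℝ) ∞) where
  carrier := {y | ∃ x : Γ → ℝ, ∀ γ, y γ = D.J m x γ}
  add_mem' := by
    rintro y z ⟨x, hx⟩ ⟨x', hx'⟩
    exact ⟨x + x', fun γ => by simp [hx, hx', J, pairing_add]⟩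
  zero_mem' := ⟨0, fun γ => by simp [J, pairing]⟩
  smul_mem' := by
    rintro r y ⟨x, hx⟩
    exact ⟨r • x, fun γ => by simp [hx, J, pairing_smul]⟩

/-- The Bourgain-Delbaen space `Y`: the norm closure of `⋃ Yₘ` in `ℓ_∞(Γ)`. -/
noncomputable def Y : Submodule ℝ (lp (fun _ : Γ => ℝ) ∞) :=
  (⨆ m, D.Ym m).topologicalClosure

/-- `Fₘ = (P_{[1,m]} - P_{[1,m-1]})(Y)`, where `P_{[1,m]} = Jₘ ∘ Rₘ`, as a subspace of `Y`. -/
noncomputable def F (m : ℕ) : Submodule ℝ D.Y where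
  carrier := {z | ∃ y : D.Y, ∀ γ, z.1 γ = D.J m y.1 γ - D.J (m - 1) y.1 γ}
  add_mem' := by
    rintro z w ⟨y, hy⟩ ⟨y', hy'⟩
    refine ⟨y + y', fun γ => ?_⟩
    simp only [Submodule.coe_add, lp.coeFn_add, Pi.add_apply, hy, hy', J, pairing_add]
    ring
  zero_mem' := ⟨0, fun γ => by simp [J, pairing]⟩
  smul_mem' := by
    rintro r z ⟨y, hy⟩
    refine ⟨r • y, fun γ => ?_⟩
    simp only [Submodule.coe_smul, lp.coeFn_smul, Pi.smul_apply, hy, J, pairing_smul, smul_eq_mul]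
    ring

end BourgainDelbaenSets

/-! ### Decompositions from projections -/

section FDD

variable {Z : Type*} [NormedAddCommGroup Z] [NormedSpace ℝ Z]

/-! Everything rests on a uniform bound for the projections `P*_{[1,m]}` on the unit vectors
(`WeightCondition.l1norm_projStar_single_le`), proved by induction on the rank. If `γ` has type 1
and `rk ξ ≤ m < rk γ`, then `P*_{[1,m]} e*_γ = α e*_ξ + β P*_{(k,m]} b*`. The second term has norm
at most `θ · 2M` if `β ≤ θ`. Otherwise `b* = e*_η = d*_η` is kept or killed by the projection, so
the norm is at most 1. Any `M ≥ 2` with `1 + 2θM ≤ M` therefore works. The projections extend to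
`ℓ₁(Γ)`, and the operators `Jₘ Rₘ` are their adjoints on `Y`; both FDDs follow.

The compactness criterion holds because nonempty initial segments of cut sets are cut sets: an
infinite set in the closure of the family yields an infinite chain of its initial segments.

For shrinking, let `K` be the weak-star closure of the unit vectors in `Y*`, so that `Y` embeds
isometrically in `C(K)`. A point of `K` is a limit of unit vectors along an ultrafilter. Without
infinite chains their cuts stabilize to a finite set with last element `p`, while the next cut tends
to infinity. Beyond `p` the unit vector acts as a vector of norm at most `θ`, or as a multiple of
some `d*_η`, which contributes nothing in the limit on tails. Each point of `K` thus agrees on tails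
with a functional of norm at most `θ` (`exists_small_of_mem_closure`). Hence an asymptotic bound `a
‖f‖` for all functionals `f` on a bounded sequence of tails gives the pointwise bound `θ a` on `K`.
Integration against a measure representing `f` turns this into the bound `θ a ‖f‖`
(`eventually_abs_le_improve`). Iteration gives convergence to 0, that is, `f ∘ Pₙ → f` in norm
(`tendsto_comp_projY`).

Finally, `ℓ₁ → Y*` is bounded below, and its closed range contains every `f ∘ Pₙ`, hence every `f`.
-/

theorem projection_sum {P : ℕ → Z →L[ℝ] Z} {E : ℕ → Submodule ℝ Z}
    (hlt : ∀ i n x, x ∈ E i → i < n → P n x = x) (hle : ∀ i n x, x ∈ E i → n ≤ i → P n x = 0)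
    {s : ℕ → Z} (hs : ∀ i, s i ∈ E i) {n N : ℕ} (h : n ≤ N) :
    P n (∑ i ∈ Finset.range N, s i) = ∑ i ∈ Finset.range n, s i := by
  obtain ⟨k, rfl⟩ := Nat.exists_eq_add_of_le h
  rw [Finset.sum_range_add, map_add, map_sum, map_sum, Finset.sum_congr rfl fun i hi =>
    hlt i n (s i) (hs i) (Finset.mem_range.1 hi), Finset.sum_congr rfl fun i _ =>
    hle (n + i) n (s (n + i)) (hs _) (Nat.le_add_right _ _)]
  simp

theorem isFDD_of_projections {P : ℕ → Z →L[ℝ] Z} {E : ℕ → Submodule ℝ Z}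
    (hfin : ∀ i, FiniteDimensional ℝ (E i)) (h0 : P 0 = 0)
    (hlt : ∀ i n x, x ∈ E i → i < n → P n x = x) (hle : ∀ i n x, x ∈ E i → n ≤ i → P n x = 0)
    (hmem : ∀ i x, P (i + 1) x - P i x ∈ E i)
    (hlim : ∀ x, Tendsto (fun n => P n x) atTop (𝓝 x)) : IsFDD E := by
  refine ⟨hfin, fun x => ⟨fun i => P (i + 1) x - P i x, ⟨fun i => hmem i x, ?_⟩, ?_⟩⟩
  · simpa [Finset.sum_range_sub (fun i => P i x), h0] using hlim x
  · rintro s ⟨hs, hx⟩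
    -- Continuity of `P m` forces the partial sums of any expansion, and so its terms.
    have key : ∀ m, P m x = ∑ i ∈ Finset.range m, s i := fun m => by
      refine tendsto_nhds_unique (((P m).continuous.tendsto x).comp hx)
        (tendsto_const_nhds.congr' ?_)
      filter_upwards [eventually_ge_atTop m] with n hn
      exact (projection_sum hlt hle hs hn).symm
    funext i
    simp [key, Finset.sum_range_succ]

theorem decompositionConstantLE_of_projections {P : ℕ → Z →L[ℝ] Z} {E : ℕ → Submodule ℝ Z} {M : ℝ}
    (hlt : ∀ i n x, x ∈ E i → i < n → P n x = x) (hle : ∀ i n x, x ∈ E i → n ≤ i → P n x = 0)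
    (hM : ∀ n x, ‖P n x‖ ≤ M * ‖x‖) : DecompositionConstantLE E M := by
  intro s hs n N h
  rw [← projection_sum hlt hle hs h]
  exact hM _ _

/-- The vectors at which a uniformly bounded sequence of operators converges to the identity form
a closed subspace. -/
theorem tendsto_id_of_mem_topologicalClosure {P : ℕ → Z →L[ℝ] Z} {M : ℝ}
    (hM : ∀ n x, ‖P n x‖ ≤ M * ‖x‖) {V : Submodule ℝ Z}
    (hV : ∀ x ∈ V, Tendsto (fun n => P n x) atTop (𝓝 x)) {x : Z} (hx : x ∈ V.topologicalClosure) :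
    Tendsto (fun n => P n x) atTop (𝓝 x) := by
  rw [Metric.tendsto_atTop]
  intro ε hε
  have hM0 : 0 < |M| + 2 := by positivity
  -- Three errors add up below, with coefficients `|M|`, 1 and 1.
  obtain ⟨y, hy, hxy⟩ := Metric.mem_closure_iff.1 hx (ε / (|M| + 2)) (by positivity)
  obtain ⟨n₀, hn₀⟩ := Metric.tendsto_atTop.1 (hV y hy) (ε / (|M| + 2)) (by positivity)
  refine ⟨n₀, fun n hn => ?_⟩
  have h1 := hn₀ n hn
  have h2 : ‖P n (x - y)‖ ≤ |M| * ‖x - y‖ :=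
    (hM n _).trans (by gcongr; exact le_abs_self M)
  rw [dist_eq_norm] at *
  have h3 : P n x - x = P n (x - y) + (P n y - y) - (x - y) := by rw [map_sub]; abel
  have h4 : ‖P n x - x‖ ≤ ‖P n (x - y)‖ + ‖P n y - y‖ + ‖x - y‖ := by
    rw [h3]
    exact (norm_sub_le _ _).trans (by gcongr; exact norm_add_le _ _)
  have h5 : |M| * ‖x - y‖ ≤ |M| * (ε / (|M| + 2)) := by gcongr
  have h6 : |M| * (ε / (|M| + 2)) + ε / (|M| + 2) + ε / (|M| + 2) = ε := by field_simp; ring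
  linarith

end FDD

/-! ### Operators on `ℓ₁` -/

section L1

variable {ι : Type*}

theorem lp_one_summable (b : lp (fun _ : ι => ℝ) 1) : Summable fun i => |b i| := by
  simpa using (lp.memℓp b).summable (by norm_num)

theorem lp_one_norm (b : lp (fun _ : ι => ℝ) 1) : ‖b‖ = ∑' i, |b i| := by
  simpa using lp.norm_eq_tsum_rpow (p := 1) (by norm_num) b

variable {E : Type*} [NormedAddCommGroup E] [NormedSpace ℝ E] [CompleteSpace E]

theorem l1Lift_summable {w : ι → E} {C : ℝ} (hw : ∀ i, ‖w i‖ ≤ C) (b : lp (fun _ : ι => ℝ) 1) :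
    Summable fun i => b i • w i := by
  refine Summable.of_norm_bounded ((lp_one_summable b).mul_right C) fun i => ?_
  rw [norm_smul, Real.norm_eq_abs]
  exact mul_le_mul_of_nonneg_left (hw i) (abs_nonneg _)

/-- The operator on `ℓ₁(ι)` which maps the unit vectors to a given bounded family. -/
noncomputable def l1Lift (w : ι → E) (C : ℝ) (hw : ∀ i, ‖w i‖ ≤ C) :
    lp (fun _ : ι => ℝ) 1 →L[ℝ] E :=
  LinearMap.mkContinuous
    { toFun := fun b => ∑' i, b i • w i
      map_add' := fun b b' => by
        simp only [lp.coeFn_add, Pi.add_apply, add_smul]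
        exact (l1Lift_summable hw b).tsum_add (l1Lift_summable hw b')
      map_smul' := fun r b => by
        simp only [lp.coeFn_smul, Pi.smul_apply, smul_assoc, RingHom.id_apply]
        exact (l1Lift_summable hw b).tsum_const_smul r } C fun b => by
    change ‖∑' i, b i • w i‖ ≤ C * ‖b‖
    rw [lp_one_norm, ← tsum_mul_left]
    refine tsum_of_norm_bounded ((lp_one_summable b).mul_left C).hasSum fun i => ?_
    rw [norm_smul, Real.norm_eq_abs, mul_comm]
    exact mul_le_mul_of_nonneg_right (hw i) (abs_nonneg _)

theorem l1Lift_apply (w : ι → E) (C : ℝ) (hw : ∀ i, ‖w i‖ ≤ C) (b : lp (fun _ : ι => ℝ) 1) :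
    l1Lift w C hw b = ∑' i, b i • w i := rfl

theorem norm_l1Lift_le (w : ι → E) {C : ℝ} (hC : 0 ≤ C) (hw : ∀ i, ‖w i‖ ≤ C) :
    ‖l1Lift w C hw‖ ≤ C :=
  LinearMap.mkContinuous_norm_le _ hC _

theorem l1Lift_single [DecidableEq ι] (w : ι → E) (C : ℝ) (hw : ∀ i, ‖w i‖ ≤ C) (i : ι) (r : ℝ) :
    l1Lift w C hw (lp.single 1 i r) = r • w i := by
  rw [l1Lift_apply, tsum_eq_single i]
  · simp
  · intro j hj
    simp [hj]

end L1

/-! ### An integral criterion for convergence of functionals -/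

section Integral

variable {X : Type*} [TopologicalSpace X] [CompactSpace X]

variable {V : Type*} [AddCommGroup V] [Module ℝ V]

/-- A functional on a space of continuous functions, bounded by `c` times the supremum norm, is
dominated by a positive functional of mass `c`. -/
theorem exists_positive_dominating [Nonempty X] (Φ : V →ₗ[ℝ] C(X, ℝ)) (f : V →ₗ[ℝ] ℝ) {c : ℝ} (hc : 0 ≤ c)
    (hf : ∀ y, |f y| ≤ c * ‖Φ y‖) :
    ∃ Λ : C(X, ℝ) →ₗ[ℝ] ℝ, (∀ h, 0 ≤ h → 0 ≤ Λ h) ∧ Λ 1 = c ∧ ∀ y, |f y| ≤ Λ |Φ y| := by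
  -- The functional `(y, t·1) ↦ f y + c t` is positive for this cone by the bound on `f`, so it
  -- extends positively to `V × C(X, ℝ)`. Put `Λ h` for its value at `(0, h)`. The cone contains
  -- `(±y, |Φ y|)`, which gives the domination.
  let s : PointedCone ℝ (V × C(X, ℝ)) :=
    { carrier := {q | ∀ x, |Φ q.1 x| ≤ q.2 x}
      add_mem' := fun {q r} hq hr x => by
        simpa using (abs_add_le _ _).trans (add_le_add (hq x) (hr x))
      zero_mem' := fun x => by simp
      smul_mem' := fun t q hq x => by
        have := mul_le_mul_of_nonneg_left (hq x) t.2
        change |Φ ((t : ℝ) • q.1) x| ≤ (t : ℝ) * q.2 x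
        rw [map_smul]
        change |(t : ℝ) * Φ q.1 x| ≤ (t : ℝ) * q.2 x
        rwa [abs_mul, abs_of_nonneg t.2] }
  let j : V × ℝ →ₗ[ℝ] V × C(X, ℝ) :=
    LinearMap.prodMap LinearMap.id (LinearMap.toSpanSingleton ℝ C(X, ℝ) 1)
  have hjapp : ∀ q, j q = (q.1, q.2 • (1 : C(X, ℝ))) := fun q => rfl
  have hj : Function.Injective j := by
    rintro ⟨y, t⟩ ⟨y', t'⟩ h
    rw [hjapp, hjapp, Prod.mk.injEq] at h
    obtain ⟨x⟩ := ‹Nonempty X›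
    have := DFunLike.congr_fun h.2 x
    simp at this
    exact Prod.ext h.1 this
  let e := LinearEquiv.ofInjective j hj
  let F : V × ℝ →ₗ[ℝ] ℝ := f.comp (LinearMap.fst ℝ V ℝ) + c • LinearMap.snd ℝ V ℝ
  let p : (V × C(X, ℝ)) →ₗ.[ℝ] ℝ := ⟨LinearMap.range j, F.comp e.symm.toLinearMap⟩
  have hp : ∀ q, ∃ hq : j q ∈ p.domain, p ⟨j q, hq⟩ = f q.1 + c * q.2 := fun q => by
    refine ⟨⟨q, rfl⟩, ?_⟩
    change F (e.symm (e q)) = _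
    rw [e.symm_apply_apply]
    simp [F]
  obtain ⟨g, hg, hpos⟩ := riesz_extension s p
    (by
      rintro ⟨_, ⟨q, rfl⟩⟩ h
      obtain ⟨_, h2⟩ := hp q
      rw [h2]
      have h3 : ‖Φ q.1‖ ≤ q.2 := (ContinuousMap.norm_le_of_nonempty _).2 fun x => by
        simpa [hjapp] using h x
      have h4 := (abs_le.1 (hf q.1)).1
      have := mul_le_mul_of_nonneg_left h3 hc
      linarith)
    (by
      rintro ⟨y, h⟩
      -- The sum with `(y, h)` is `(0, h + ‖h‖)`, and `h + ‖h‖ ≥ 0`.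
      refine ⟨⟨j (-y, ‖h‖), (hp _).1⟩, fun x => ?_⟩
      have := (abs_le.1 (h.norm_coe_le_norm x)).1
      simp [hjapp]
      linarith)
  have hgj : ∀ q, g (j q) = f q.1 + c * q.2 := fun q => by
    obtain ⟨h1, h2⟩ := hp q
    rw [← h2, ← hg]
  have key : ∀ y, 0 ≤ f y + g (0, |Φ y|) := fun y => by
    have h1 := hpos (y, |Φ y|) fun x => by simp
    have h2 := hgj (y, 0)
    have h3 : ((y, |Φ y|) : V × C(X, ℝ)) = j (y, 0) + (0, |Φ y|) := by simp [hjapp]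
    rw [h3, map_add, h2] at h1
    simpa using h1
  refine ⟨g.comp (LinearMap.inr ℝ V C(X, ℝ)), fun h hh => hpos _ fun x => ?_, ?_, fun y => ?_⟩
  · simpa using hh x
  · have := hgj (0, 1)
    rw [hjapp] at this
    simpa using this
  · have h1 := key y
    have h2 := key (-y)
    simp only [map_neg, abs_neg] at h2
    change |f y| ≤ g (0, |Φ y|)
    rw [abs_le]
    constructor <;> linarith

/-- Riesz–Markov–Kakutani; on a compact space every continuous function has compact support. -/
theorem exists_measure_of_positive [T2Space X] [MeasurableSpace X] [BorelSpace X] (Λ : C(X, ℝ) →ₗ[ℝ] ℝ)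
    (hΛ : ∀ h, 0 ≤ h → 0 ≤ Λ h) :
    ∃ μ : MeasureTheory.Measure X, MeasureTheory.IsFiniteMeasure μ ∧
      ∀ h : C(X, ℝ), ∫ x, h x ∂μ = Λ h := by
  let T : CompactlySupportedContinuousMap X ℝ →ₗ[ℝ] ℝ :=
    { toFun := fun h => Λ h.toContinuousMap
      map_add' := fun h h' => Λ.map_add h.toContinuousMap h'.toContinuousMap
      map_smul' := fun r h => Λ.map_smul r h.toContinuousMap }
  let T' : CompactlySupportedContinuousMap X ℝ →ₚ[ℝ] ℝ :=
    PositiveLinearMap.mk₀ T fun h hh => hΛ _ fun x => hh x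
  refine ⟨RealRMK.rieszMeasure T', ⟨?_⟩, fun h => ?_⟩
  · exact isCompact_univ.measure_lt_top
  · exact RealRMK.integral_rieszMeasure T' (CompactlySupportedContinuousMap.continuousMapEquiv h)

/-- The excess `(|Φ (z n)| - a)⁺` is bounded and tends to 0 pointwise, so its integral against a
measure dominating `f` tends to 0. The remaining part of `|Φ (z n)|` is at most `a` and contributes
at most `a * c`, where `c` is the mass of the measure. -/
theorem eventually_abs_le_of_pointwise [T2Space X] [Nonempty X] (Φ : V →ₗ[ℝ] C(X, ℝ)) (f : V →ₗ[ℝ] ℝ) {c : ℝ}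
    (hc : 0 ≤ c) (hf : ∀ y, |f y| ≤ c * ‖Φ y‖) {z : ℕ → V} {B a : ℝ} (hB : ∀ n, ‖Φ (z n)‖ ≤ B) (ha : 0 ≤ a)
    (hz : ∀ x, ∀ ε > 0, ∀ᶠ n in atTop, |Φ (z n) x| ≤ a + ε) :
    ∀ ε > 0, ∀ᶠ n in atTop, |f (z n)| ≤ a * c + ε := by
  borelize X
  obtain ⟨Λ, hΛ, hΛ1, hfΛ⟩ := exists_positive_dominating Φ f hc hf
  obtain ⟨μ, hμ, hint⟩ := exists_measure_of_positive Λ hΛ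
  let k : ℕ → C(X, ℝ) := fun n => (|Φ (z n)| - a • 1) ⊔ 0
  have hk : ∀ n x, k n x = max (|Φ (z n) x| - a) 0 := fun n x => by simp [k]
  have hk0 : Tendsto (fun n => Λ (k n)) atTop (𝓝 0) := by
    have : Tendsto (fun n => ∫ x, k n x ∂μ) atTop (𝓝 (∫ _, (0 : ℝ) ∂μ)) := by
      refine MeasureTheory.tendsto_integral_of_dominated_convergence (fun _ => max B 0)
        (fun n => (k n).continuous.aestronglyMeasurable) (MeasureTheory.integrable_const _)
        (fun n => Eventually.of_forall fun x => ?_) (Eventually.of_forall fun x => ?_)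
      · have h1 := ((Φ (z n)).norm_coe_le_norm x).trans (hB n)
        rw [Real.norm_eq_abs] at h1
        rw [hk, Real.norm_eq_abs, abs_of_nonneg (le_max_right _ _)]
        exact max_le_max (by linarith) le_rfl
      · rw [Metric.tendsto_atTop']
        intro ε hε
        obtain ⟨n₀, h⟩ := eventually_atTop.1 (hz x (ε / 2) (by linarith))
        refine ⟨n₀, fun n hn => ?_⟩
        have h1 := h n hn.le
        rw [hk, Real.dist_eq, sub_zero, abs_of_nonneg (le_max_right _ _)]
        exact max_lt (by linarith) hε
    simpa [hint] using this
  intro ε hε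
  filter_upwards [hk0.eventually (eventually_le_nhds hε)] with n hn
  have h1 : 0 ≤ Λ (k n + a • 1 - |Φ (z n)|) := hΛ _ fun x => by
    have := le_max_left (|Φ (z n) x| - a) 0
    simp [hk]
    linarith
  rw [map_sub, map_add, map_smul, hΛ1, smul_eq_mul] at h1
  linarith [hfΛ (z n)]

end Integral

namespace BourgainDelbaenSets

/-! ### The `ℓ₁`-norm of finitely supported vectors -/

section Norm

variable {Γ : Type u}

/-- The embedding of `c₀₀(Γ)` into `ℓ₁(Γ)` as a linear map. -/
noncomputable def toL1ₗ : (Γ →₀ ℝ) →ₗ[ℝ] lp (fun _ : Γ => ℝ) 1 where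
  toFun := toL1
  map_add' _ _ := rfl
  map_smul' _ _ := rfl

theorem toL1ₗ_apply (b : Γ →₀ ℝ) : toL1ₗ b = toL1 b := rfl

theorem norm_toL1 (b : Γ →₀ ℝ) : ‖toL1 b‖ = l1norm b := by
  rw [lp_one_norm, l1norm, Finsupp.sum]
  refine tsum_eq_sum fun i hi => ?_
  change |b i| = 0
  simpa using hi

theorem toL1_single [DecidableEq Γ] (γ : Γ) (r : ℝ) :
    toL1 (Finsupp.single γ r) = lp.single 1 γ r := by
  ext η
  change Finsupp.single γ r η = _
  by_cases h : η = γ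
  · subst h; simp
  · simp [h]

theorem l1norm_nonneg (b : Γ →₀ ℝ) : 0 ≤ l1norm b := by
  rw [← norm_toL1]
  exact norm_nonneg _

theorem l1norm_add_le (b b' : Γ →₀ ℝ) : l1norm (b + b') ≤ l1norm b + l1norm b' := by
  simp only [← norm_toL1, ← toL1ₗ_apply, map_add]
  exact norm_add_le _ _

theorem l1norm_sub_le (b b' : Γ →₀ ℝ) : l1norm (b - b') ≤ l1norm b + l1norm b' := by
  simp only [← norm_toL1, ← toL1ₗ_apply, map_sub]
  exact norm_sub_le _ _

theorem l1norm_smul (r : ℝ) (b : Γ →₀ ℝ) : l1norm (r • b) = |r| * l1norm b := by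
  simp only [← norm_toL1, ← toL1ₗ_apply, map_smul]
  exact norm_smul _ _

theorem l1norm_zero : l1norm (0 : Γ →₀ ℝ) = 0 := by simp [l1norm]

theorem l1norm_single (γ : Γ) (r : ℝ) : l1norm (Finsupp.single γ r) = |r| := by simp [l1norm]

end Norm

variable {Γ : Type u} (D : BourgainDelbaenSets Γ)

/-! ### The projections on the unit vectors -/

theorem single_eq_d_add_c (γ : Γ) : Finsupp.single γ (1 : ℝ) = D.d γ + D.c γ := by simp [d]

theorem projStar_Ioc {k m : ℕ} (h : k ≤ m) (b : Γ →₀ ℝ) :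
    D.projStar (Set.Ioc k m) b = D.projStar (Set.Iic m) b - D.projStar (Set.Iic k) b := by
  classical
  have h2 : D.projStar (Set.Ioc k m) = D.projStar (Set.Iic m) - D.projStar (Set.Iic k) := by
    refine D.dBasis.ext fun η => ?_
    simp only [dBasis_apply, projStar_d, LinearMap.sub_apply, Set.mem_Ioc, Set.mem_Iic]
    by_cases hA : D.rk η ≤ k
    · simp [hA, hA.trans h, hA.not_gt]
    · simp [hA, not_le.1 hA]
  rw [h2, LinearMap.sub_apply]

theorem projStar_empty (b : Γ →₀ ℝ) : D.projStar ∅ b = 0 := by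
  classical
  have : D.projStar ∅ = 0 := D.dBasis.ext fun η => by simp [projStar_d]
  rw [this, LinearMap.zero_apply]

theorem projStar_Iic_zero (b : Γ →₀ ℝ) : D.projStar (Set.Iic 0) b = 0 := by
  classical
  have : D.projStar (Set.Iic 0) = 0 := D.dBasis.ext fun η => by
    have := D.one_le_rk η
    have h : D.rk η ≠ 0 := by omega
    simp [projStar_d, h]
  rw [this, LinearMap.zero_apply]

theorem projStar_single_of_lt {m : ℕ} {γ : Γ} (h : m < D.rk γ) :
    D.projStar (Set.Iic m) (Finsupp.single γ 1) = D.projStar (Set.Iic m) (D.c γ) := by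
  classical
  rw [single_eq_d_add_c, map_add, projStar_d, if_neg (by simpa using h), zero_add]

theorem projStar_single_of_zero {m : ℕ} {γ : Γ} {β : ℝ} {b : Γ →₀ ℝ} (h : m < D.rk γ)
    (hl : D.label γ = .zero β b) :
    D.projStar (Set.Iic m) (Finsupp.single γ 1) = β • D.projStar (Set.Iic m) b := by
  rw [D.projStar_single_of_lt h, D.c_eq_of_zero hl, map_smul]

theorem projStar_single_of_one {m : ℕ} {γ ξ : Γ} {α β : ℝ} {b : Γ →₀ ℝ} (h : m < D.rk γ)
    (hl : D.label γ = .one α ξ β b) :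
    D.projStar (Set.Iic m) (Finsupp.single γ 1) =
      α • D.projStar (Set.Iic m) (Finsupp.single ξ 1) + β • D.projStar (Set.Ioc (D.rk ξ) m) b := by
  rw [D.projStar_single_of_lt h, D.c_eq_of_one hl, map_add, map_smul, map_smul, projStar_projStar]
  congr 4
  ext x
  simp only [Set.mem_inter_iff, Set.mem_Iic, Set.mem_Ioc]
  omega

/-- Here `e*_η = d*_η` is itself a basis vector. This is why the exceptional `b*` of the weight
condition need no small weight. -/
theorem projStar_single_of_c_eq_zero (A : Set ℕ) {η : Γ} (h : D.c η = 0) :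
    D.projStar A (Finsupp.single η 1) = 0 ∨
      D.projStar A (Finsupp.single η 1) = Finsupp.single η 1 := by
  classical
  have h1 : Finsupp.single η (1 : ℝ) = D.d η := by simp [d, h]
  rw [h1, projStar_d]
  split_ifs <;> simp

theorem l1norm_projStar_single_of_c_eq_zero (A : Set ℕ) {η : Γ} (h : D.c η = 0) :
    l1norm (D.projStar A (Finsupp.single η 1)) ≤ 1 := by
  rcases D.projStar_single_of_c_eq_zero A h with h | h <;> rw [h]
  · simp [l1norm_zero]
  · simp [l1norm_single]

variable {D}

theorem WeightCondition.mono {θ θ' : ℝ} (hD : D.WeightCondition θ) (h : θ ≤ θ') :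
    D.WeightCondition θ' :=
  ⟨fun γ β b hl => (hD.1 γ β b hl).imp_left fun h' => h'.trans h,
    fun γ α ξ β b hl => (hD.2 γ α ξ β b hl).imp_left fun h' => h'.trans h⟩

/-- The projections `P*_{[1,m]}` are uniformly bounded. -/
theorem WeightCondition.l1norm_projStar_single_le {θ M : ℝ} (hD : D.WeightCondition θ)
    (hθ : 0 ≤ θ) (hM2 : 2 ≤ M) (hM : 1 + 2 * θ * M ≤ M) (γ : Γ) :
    ∀ m, l1norm (D.projStar (Set.Iic m) (Finsupp.single γ 1)) ≤ M := by
  induction hn : D.rk γ using Nat.strong_induction_on generalizing γ with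
  | _ n ih =>
    subst hn
    intro m
    rcases le_or_gt (D.rk γ) m with hm | hm
    · rw [D.projStar_single_of_le hm, l1norm_single, abs_one]
      linarith
    -- By convexity the induction hypothesis passes from unit vectors to the unit ball.
    have hproj : ∀ b : Γ →₀ ℝ, (∀ η ∈ b.support, D.rk η < D.rk γ) → l1norm b ≤ 1 →
        ∀ m', l1norm (D.projStar (Set.Iic m') b) ≤ M := by
      intro b hb hb1 m'
      rw [projStar_eq_sum, ← norm_toL1, ← toL1ₗ_apply, map_sum]
      have : ∑ η ∈ b.support, |b η| * M ≤ M := by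
        rw [← Finset.sum_mul]
        have h0 : ∑ η ∈ b.support, |b η| ≤ 1 := hb1
        nlinarith
      refine (norm_sum_le_of_le _ fun η hη => ?_).trans this
      rw [toL1ₗ_apply, norm_toL1, l1norm_smul]
      exact mul_le_mul_of_nonneg_left (ih _ (hb η hη) η rfl m') (abs_nonneg _)
    cases hl : D.label γ with
    | initial =>
      rw [D.projStar_single_of_lt hm, D.c_eq_zero_of_initial hl, map_zero, l1norm_zero]
      linarith
    | zero β b =>
      have hs := D.zero_spec γ β b hl
      rw [D.projStar_single_of_zero hm hl, l1norm_smul, abs_of_nonneg hs.1.1]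
      rcases le_or_gt (l1norm (D.projStar (Set.Iic m) b)) M with h | h
      · nlinarith [l1norm_nonneg (D.projStar (Set.Iic m) b)]
      · exact absurd (hproj b hs.2.1 hs.2.2 m) (not_le.2 h)
    | one α ξ β b =>
      obtain ⟨⟨hα0, hα1⟩, ⟨hβ0, hβ1⟩, hξ, hb, hb1⟩ := D.one_spec γ α ξ β b hl
      rw [D.projStar_single_of_one hm hl]
      refine (l1norm_add_le _ _).trans ?_
      rw [l1norm_smul, l1norm_smul, abs_of_nonneg hα0, abs_of_nonneg hβ0]
      rcases lt_or_ge m (D.rk ξ) with h | h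
      · rw [Set.Ioc_eq_empty_of_le h.le, projStar_empty, l1norm_zero, mul_zero, add_zero]
        have := ih _ (by omega) ξ rfl m
        nlinarith
      · rw [D.projStar_single_of_le h, l1norm_single, abs_one, mul_one]
        have h1 : β * l1norm (D.projStar (Set.Ioc (D.rk ξ) m) b) ≤ M - 1 := by
          rcases hD.2 γ α ξ β b hl with h2 | ⟨η, -, -, rfl, hη⟩
          -- An interval projection is a difference of two initial ones; this is the origin of the
          -- factor 2 in `1 + 2θM`.
          · have h3 : l1norm (D.projStar (Set.Ioc (D.rk ξ) m) b) ≤ M + M := by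
              rw [D.projStar_Ioc h]
              exact (l1norm_sub_le _ _).trans (add_le_add (hproj b (fun η hη => (hb η hη).2) hb1 _)
                (hproj b (fun η hη => (hb η hη).2) hb1 _))
            have := mul_le_mul h2 h3 (l1norm_nonneg _) hθ
            linarith
          · have := D.l1norm_projStar_single_of_c_eq_zero (Set.Ioc (D.rk ξ) m) hη
            have := mul_le_mul hβ1 this (l1norm_nonneg _) zero_le_one
            linarith
        linarith

variable (D)

/-! ### Cuts -/

theorem cuts_of_ne_one {γ : Γ} (h : ∀ α ξ β b, D.label γ ≠ .one α ξ β b) :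
    D.cuts γ = {D.rk γ} := by
  rw [cuts]
  split
  · rfl
  · rfl
  · exact absurd ‹_› (h _ _ _ _)

theorem cuts_of_one {γ ξ : Γ} {α β : ℝ} {b : Γ →₀ ℝ} (h : D.label γ = .one α ξ β b) :
    D.cuts γ = insert (D.rk γ) (D.cuts ξ) := by
  rw [cuts]
  split <;> simp_all

theorem rk_mem_cuts (γ : Γ) : D.rk γ ∈ D.cuts γ := by
  rw [cuts]
  split <;> simp

theorem le_rk_of_mem_cuts (γ : Γ) : ∀ p ∈ D.cuts γ, p ≤ D.rk γ := by
  induction hn : D.rk γ using Nat.strong_induction_on generalizing γ with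
  | _ n ih =>
    subst hn
    intro p hp
    by_cases h : ∃ α ξ β b, D.label γ = .one α ξ β b
    · obtain ⟨α, ξ, β, b, hl⟩ := h
      have hξ := (D.one_spec γ α ξ β b hl).2.2.1
      rw [D.cuts_of_one hl, Finset.mem_insert] at hp
      rcases hp with rfl | hp
      · exact le_rfl
      · have := ih _ (by omega) ξ rfl p hp
        omega
    · push Not at h
      rw [D.cuts_of_ne_one h, Finset.mem_singleton] at hp
      exact hp.le

/-- Nonempty initial segments of cut sets are cut sets. -/
theorem filter_cuts_mem (γ : Γ) (n : ℕ) :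
    (D.cuts γ).filter (· ≤ n) = ∅ ∨ (D.cuts γ).filter (· ≤ n) ∈ D.cutFamily := by
  induction hn : D.rk γ using Nat.strong_induction_on generalizing γ with
  | _ r ih =>
    subst hn
    rcases le_or_gt (D.rk γ) n with hm | hm
    · right
      refine ⟨γ, (Finset.filter_true_of_mem fun p hp => ?_).symm⟩
      exact (D.le_rk_of_mem_cuts γ p hp).trans hm
    by_cases h : ∃ α ξ β b, D.label γ = .one α ξ β b
    · obtain ⟨α, ξ, β, b, hl⟩ := h
      have hξ := (D.one_spec γ α ξ β b hl).2.2.1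
      rw [D.cuts_of_one hl, Finset.filter_insert, if_neg (by omega)]
      exact ih _ (by omega) ξ rfl
    · push Not at h
      left
      rw [D.cuts_of_ne_one h, Finset.filter_singleton, if_neg (by omega)]

/-- If all initial segments of an infinite set are initial segments of cut sets, there is an
infinite increasing chain of cut sets. -/
theorem hasInfiniteIncreasingChain_of_infinite {A : Set ℕ} (hA : A.Infinite)
    (h : ∀ n, ∃ γ, ∀ p ≤ n, p ∈ D.cuts γ ↔ p ∈ A) : HasInfiniteIncreasingChain D.cutFamily := by
  choose g hg using h
  let a := Nat.nth (· ∈ A)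
  have ha : StrictMono a := Nat.nth_strictMono hA
  have haA : ∀ i, a i ∈ A := fun i => Nat.nth_mem_of_infinite hA i
  have hmem : ∀ i p, p ∈ (D.cuts (g (a i))).filter (· ≤ a i) ↔ p ∈ A ∧ p ≤ a i := fun i p => by
    rw [Finset.mem_filter]
    exact and_congr_left fun hp => hg _ p hp
  refine ⟨fun i => (D.cuts (g (a i))).filter (· ≤ a i), strictMono_nat_of_lt_succ fun i => ?_,
    fun i => (D.filter_cuts_mem _ _).resolve_left
      (Finset.Nonempty.ne_empty ⟨a i, (hmem i _).2 ⟨haA i, le_rfl⟩⟩)⟩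
  have hlt := ha (Nat.lt_succ_self i)
  refine Finset.ssubset_iff_subset_ne.2 ⟨fun p hp => ?_, fun heq => ?_⟩
  · rw [hmem] at hp ⊢
    exact ⟨hp.1, hp.2.trans hlt.le⟩
  · have h1 : a (i + 1) ∈ (D.cuts (g (a (i + 1)))).filter (· ≤ a (i + 1)) :=
      (hmem _ _).2 ⟨haA _, le_rfl⟩
    rw [← heq, hmem] at h1
    exact absurd h1.2 (not_le.2 hlt)

theorem isCompact_closure_cutFamily_iff :
    IsCompact (closure (FinSubsets.of '' D.cutFamily)) ↔
      ¬ HasInfiniteIncreasingChain D.cutFamily := by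
  constructor
  -- The union of the chain is a pointwise limit, so compactness makes it a finite set; but `A i`
  -- has at least `i` elements.
  · rintro hK ⟨A, hA, hAC⟩
    have hcl : IsClosed (Subtype.val '' closure (FinSubsets.of '' D.cutFamily)) :=
      (hK.image continuous_subtype_val).isClosed
    classical
    have hlim : Tendsto (fun i => (FinSubsets.of (A i)).1) atTop
        (𝓝 fun n => decide (∃ i, n ∈ A i)) := by
      rw [tendsto_pi_nhds]
      intro n
      refine tendsto_const_nhds.congr' ?_
      by_cases h : ∃ i, n ∈ A i
      · obtain ⟨i, hi⟩ := h
        filter_upwards [eventually_ge_atTop i] with j hj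
        have hj' : n ∈ A j := hA.monotone hj hi
        have : ∃ i, n ∈ A i := ⟨i, hi⟩
        simp [FinSubsets.of, hj', this]
      · push Not at h
        simp [FinSubsets.of, h]
    obtain ⟨x, -, hx⟩ := hcl.mem_of_tendsto hlim (Eventually.of_forall fun i =>
      ⟨_, subset_closure ⟨A i, hAC i, rfl⟩, rfl⟩)
    have hfin : {n | ∃ i, n ∈ A i}.Finite := by
      refine x.2.subset fun n hn => ?_
      rw [hx]
      exact decide_eq_true hn
    have hcard : ∀ i, i ≤ (A i).card := by
      intro i
      induction i with
      | zero => exact Nat.zero_le _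
      | succ i ih => exact Nat.succ_le_of_lt (ih.trans_lt (Finset.card_lt_card (hA i.lt_succ_self)))
    have h1 := hcard (hfin.toFinset.card + 1)
    have h2 : (A (hfin.toFinset.card + 1)).card ≤ hfin.toFinset.card :=
      Finset.card_le_card fun n hn => hfin.mem_toFinset.2 ⟨_, hn⟩
    omega
  · intro h
    have hind : Topology.IsInducing (Subtype.val : FinSubsets → ℕ → Bool) := .subtypeVal
    -- The closure in `{0,1}^ℕ` is compact, so it suffices that all its points are finite sets. An
    -- infinite one would have all its initial segments in common with cut sets.
    rw [hind.isCompact_iff, hind.closure_eq_preimage_closure_image,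
      Set.image_preimage_eq_of_subset]
    · exact isClosed_closure.isCompact
    intro x hx
    by_contra hx'
    have hinf : {n | x n = true}.Infinite := fun hf => hx' ⟨⟨x, hf⟩, rfl⟩
    refine h (D.hasInfiniteIncreasingChain_of_infinite hinf fun n => ?_)
    have hopen : IsOpen (Set.pi (Set.Iic n) fun p => ({x p} : Set Bool)) :=
      isOpen_set_pi (Set.finite_Iic n) fun _ _ => isOpen_discrete _
    obtain ⟨_, hy, _, ⟨_, ⟨γ, rfl⟩, rfl⟩, rfl⟩ := mem_closure_iff.1 hx _ hopen fun p _ => rfl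
    refine ⟨γ, fun p hp => ?_⟩
    have h1 : decide (p ∈ D.cuts γ) = x p := hy p hp
    change _ ↔ x p = true
    rw [← h1, decide_eq_true_iff]

/-! ### The part of `e*_γ` beyond a cut -/

variable {D}

/-- Up to the next cut `q` after the cut `p` of `γ`, the functional `e*_γ` is the sum of a vector
of `ℓ₁(Γ_p)` and of `P*_{(p,∞)} u`, where `u` is small or a multiple of some `e*_η = d*_η`. -/
theorem WeightCondition.exists_next_cut {θ : ℝ} (hD : D.WeightCondition θ) (hθ : 0 ≤ θ) (p : ℕ)
    (γ : Γ) (hp : p = 0 ∨ p ∈ D.cuts γ) (hpγ : p < D.rk γ) :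
    ∃ q ∈ D.cuts γ, p < q ∧ ∃ v u : Γ →₀ ℝ, (∀ η ∈ v.support, D.rk η ≤ p) ∧
      (l1norm u ≤ θ ∨ ∃ τ η, 0 ≤ τ ∧ τ ≤ 1 ∧ D.c η = 0 ∧ u = Finsupp.single η τ) ∧
      ∀ n, p ≤ n → n < q → D.projStar (Set.Iic n) (Finsupp.single γ 1) =
        v + (D.projStar (Set.Iic n) u - D.projStar (Set.Iic p) u) := by
  induction hn : D.rk γ using Nat.strong_induction_on generalizing γ with
  | _ r ih =>
    subst hn
    have hweight : ∀ (β : ℝ) (b : Γ →₀ ℝ), 0 ≤ β → β ≤ 1 → l1norm b ≤ 1 →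
        (β ≤ θ ∨ ∃ η, b = Finsupp.single η 1 ∧ D.c η = 0) →
        l1norm (β • b) ≤ θ ∨ ∃ τ η, 0 ≤ τ ∧ τ ≤ 1 ∧ D.c η = 0 ∧ β • b = Finsupp.single η τ := by
      rintro β b h0 h1 hb (h | ⟨η, rfl, hη⟩)
      · left
        rw [l1norm_smul, abs_of_nonneg h0]
        nlinarith [l1norm_nonneg b]
      · exact Or.inr ⟨β, η, h0, h1, hη, by simp⟩
    cases hl : D.label γ with
    | initial =>
      have h1 := (D.initial_iff γ).1 hl
      refine ⟨_, D.rk_mem_cuts γ, hpγ, 0, 0, by simp, Or.inl (by rwa [l1norm_zero]),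
        fun n _ hn => ?_⟩
      rw [D.projStar_single_of_lt hn, D.c_eq_zero_of_initial hl]
      simp
    | zero β b =>
      have hs := D.zero_spec γ β b hl
      -- The only cut of `γ` is `rk γ > p`.
      have hp0 : p = 0 := hp.resolve_right fun h => by
        rw [D.cuts_of_ne_one (by simp [hl]), Finset.mem_singleton] at h
        omega
      refine ⟨_, D.rk_mem_cuts γ, hpγ, 0, β • b, by simp, hweight β b hs.1.1 hs.1.2 hs.2.2
        ((hD.1 γ β b hl).imp_right fun ⟨η, h⟩ => ⟨η, h.2⟩), fun n _ hn => ?_⟩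
      rw [D.projStar_single_of_zero hn hl, hp0, projStar_Iic_zero, map_smul, zero_add, sub_zero]
    | one α ξ β b =>
      obtain ⟨⟨hα0, hα1⟩, ⟨hβ0, hβ1⟩, hξ, hb, hb1⟩ := D.one_spec γ α ξ β b hl
      have hpξ : p = 0 ∨ p ∈ D.cuts ξ := hp.imp_right fun h => by
        rw [D.cuts_of_one hl, Finset.mem_insert] at h
        exact h.resolve_left hpγ.ne
      have hpξ' : p ≤ D.rk ξ := hpξ.elim (fun h => h ▸ Nat.zero_le _) (D.le_rk_of_mem_cuts ξ p)
      -- If `p = rk ξ`, the next cut is `rk γ` and `u = β b*`. If `p < rk ξ`, the next cut is one of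
      -- `ξ`; below it the `β` term is projected to 0, and the representation for `ξ` is multiplied
      -- by `α`.
      rcases hpξ'.eq_or_lt with rfl | hlt
      · refine ⟨_, D.rk_mem_cuts γ, hpγ, α • Finsupp.single ξ 1, β • b, fun η hη => ?_,
          hweight β b hβ0 hβ1 hb1
            ((hD.2 γ α ξ β b hl).imp_right fun ⟨η, h⟩ => ⟨η, h.2.2⟩), fun n hn1 hn => ?_⟩
        · have := Finsupp.support_single_subset (Finsupp.support_smul hη)
          rw [Finset.mem_singleton.1 this]
        · rw [D.projStar_single_of_one hn hl, D.projStar_single_of_le hn1, D.projStar_Ioc hn1,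
            map_smul, map_smul, smul_sub]
      · obtain ⟨q, hq, hpq, v, u, hv, hu, hP⟩ := ih _ (by omega) ξ hpξ hlt rfl
        have hqξ := D.le_rk_of_mem_cuts ξ q hq
        refine ⟨q, by rw [D.cuts_of_one hl]; exact Finset.mem_insert_of_mem hq, hpq, α • v, α • u,
          fun η hη => hv η (Finsupp.support_smul hη), ?_, fun n hn1 hn => ?_⟩
        · rcases hu with hu | ⟨τ, η, h0, h1, hη, rfl⟩
          · left
            rw [l1norm_smul, abs_of_nonneg hα0]
            nlinarith [l1norm_nonneg u]
          · exact Or.inr ⟨α * τ, η, by positivity, by nlinarith, hη, by simp⟩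
        · rw [D.projStar_single_of_one (by omega) hl, Set.Ioc_eq_empty_of_le (by omega),
            projStar_empty, hP n hn1 hn, smul_zero, add_zero, map_smul, map_smul, smul_add,
            smul_sub]

end BourgainDelbaenSets

namespace BourgainDelbaenSets

variable {Γ : Type u} (D : BourgainDelbaenSets Γ)

/-- The projections `P*_{[1,m]}` have norm at most `M` for the `ℓ₁`-norm. -/
def ProjBound (M : ℝ) : Prop :=
  ∀ γ m, l1norm (D.projStar (Set.Iic m) (Finsupp.single γ 1)) ≤ M

theorem finite_rk_le (m : ℕ) : {γ | D.rk γ ≤ m}.Finite := by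
  have : {γ | D.rk γ ≤ m} = ⋃ n ∈ Set.Iic m, {γ | D.rk γ = n} := by ext; simp
  rw [this]
  exact (Set.finite_Iic m).biUnion fun n _ => D.finite_rk n

theorem projStar_of_support_le {m : ℕ} {b : Γ →₀ ℝ} (hb : ∀ η ∈ b.support, D.rk η ≤ m) :
    D.projStar (Set.Iic m) b = b := by
  rw [projStar_eq_sum]
  conv_rhs => rw [← Finsupp.sum_single b, Finsupp.sum]
  refine Finset.sum_congr rfl fun η hη => ?_
  rw [D.projStar_single_of_le (hb η hη)]
  simp

/-! ### The decomposition of `ℓ₁(Γ)` -/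

theorem mem_closure_range_toL1ₗ (x : lp (fun _ : Γ => ℝ) 1) :
    x ∈ (LinearMap.range (toL1ₗ (Γ := Γ))).topologicalClosure := by
  classical
  refine mem_closure_of_tendsto (lp.hasSum_single ENNReal.one_ne_top x)
    (Eventually.of_forall fun s => ?_)
  refine Submodule.sum_mem _ fun γ _ => ⟨Finsupp.single γ (x γ), ?_⟩
  rw [toL1ₗ_apply, toL1_single]

variable {D} {M : ℝ}

/-- The bounded extension of `P*_{[1,n]}` to `ℓ₁(Γ)`. -/
noncomputable def ProjBound.projL1 (hP : D.ProjBound M) (n : ℕ) :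
    lp (fun _ : Γ => ℝ) 1 →L[ℝ] lp (fun _ : Γ => ℝ) 1 :=
  l1Lift (fun γ => toL1 (D.projStar (Set.Iic n) (Finsupp.single γ 1))) M fun γ => by
    rw [norm_toL1]
    exact hP γ n

theorem ProjBound.nonneg [Nonempty Γ] (hP : D.ProjBound M) : 0 ≤ M := by
  obtain ⟨γ⟩ := ‹Nonempty Γ›
  exact (l1norm_nonneg _).trans (hP γ 0)

theorem ProjBound.projL1_toL1 (hP : D.ProjBound M) (n : ℕ) (b : Γ →₀ ℝ) :
    hP.projL1 n (toL1 b) = toL1 (D.projStar (Set.Iic n) b) := by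
  classical
  have : (hP.projL1 n).toLinearMap.comp toL1ₗ = toL1ₗ.comp (D.projStar (Set.Iic n)) := by
    ext γ : 2
    simp only [LinearMap.comp_apply, Finsupp.lsingle_apply, toL1ₗ_apply,
      ContinuousLinearMap.coe_coe, toL1_single, projL1, l1Lift_single, one_smul]
  exact LinearMap.congr_fun this b

theorem ProjBound.projL1_zero (hP : D.ProjBound M) : hP.projL1 0 = 0 := by
  ext x : 1
  rw [projL1, l1Lift_apply]
  simp only [projStar_Iic_zero, ← toL1ₗ_apply, map_zero, smul_zero, tsum_zero]
  rfl

/-- Ranks start at 1, so the summand of index `i` is `F*_{i+1}`, and the first `n` summands are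
those of ranks `1, …, n`. -/
theorem ProjBound.projL1_of_mem_lt (hP : D.ProjBound M) (i n : ℕ) (x : lp (fun _ : Γ => ℝ) 1)
    (hx : x ∈ D.Fstar (i + 1)) (h : i < n) : hP.projL1 n x = x := by
  classical
  suffices D.Fstar (i + 1) ≤ LinearMap.eqLocus (hP.projL1 n).toLinearMap LinearMap.id from this hx
  rw [Fstar, Submodule.span_le]
  rintro _ ⟨γ, hγ, rfl⟩
  change hP.projL1 n _ = _
  change D.rk γ = i + 1 at hγ
  rw [projL1_toL1, projStar_d, if_pos (by rw [Set.mem_Iic]; omega)]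
  rfl

theorem ProjBound.projL1_of_mem_le (hP : D.ProjBound M) (i n : ℕ) (x : lp (fun _ : Γ => ℝ) 1)
    (hx : x ∈ D.Fstar (i + 1)) (h : n ≤ i) : hP.projL1 n x = 0 := by
  classical
  suffices D.Fstar (i + 1) ≤ LinearMap.ker (hP.projL1 n).toLinearMap from this hx
  rw [Fstar, Submodule.span_le]
  rintro _ ⟨γ, hγ, rfl⟩
  change hP.projL1 n _ = _
  change D.rk γ = i + 1 at hγ
  rw [projL1_toL1, projStar_d, if_neg (by rw [Set.mem_Iic]; omega), ← toL1ₗ_apply, map_zero]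

theorem finiteDimensional_Fstar (n : ℕ) : FiniteDimensional ℝ (D.Fstar n) :=
  FiniteDimensional.span_of_finite ℝ ((D.finite_rk n).image _)

theorem ProjBound.projL1_sub_mem (hP : D.ProjBound M) (i : ℕ) (x : lp (fun _ : Γ => ℝ) 1) :
    hP.projL1 (i + 1) x - hP.projL1 i x ∈ D.Fstar (i + 1) := by
  classical
  have := finiteDimensional_Fstar (D := D) (i + 1)
  let T := hP.projL1 (i + 1) - hP.projL1 i
  let W : Submodule ℝ (lp (fun _ : Γ => ℝ) 1) := (D.Fstar (i + 1)).comap T.toLinearMap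
  have hcl : IsClosed (W : Set (lp (fun _ : Γ => ℝ) 1)) :=
    (Submodule.closed_of_finiteDimensional (D.Fstar (i + 1))).preimage T.continuous
  -- `W` is closed because `F*_{i+1}` is finite dimensional; hence only the basis vectors `d*_γ`
  -- need to be checked.
  refine Submodule.topologicalClosure_minimal _ ?_ hcl (mem_closure_range_toL1ₗ x)
  rw [LinearMap.range_eq_map, ← D.dBasis.span_eq, Submodule.map_span, Submodule.span_le]
  rintro _ ⟨_, ⟨γ, rfl⟩, rfl⟩
  change hP.projL1 (i + 1) (toL1ₗ (D.dBasis γ)) - hP.projL1 i (toL1ₗ (D.dBasis γ)) ∈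
    D.Fstar (i + 1)
  rw [dBasis_apply, toL1ₗ_apply, projL1_toL1, projL1_toL1, projStar_d, projStar_d,
    ← toL1ₗ_apply, ← toL1ₗ_apply, ← map_sub]
  simp only [Set.mem_Iic]
  rcases lt_trichotomy (D.rk γ) (i + 1) with h | h | h
  · rw [if_pos h.le, if_pos (by omega), sub_self, map_zero]
    exact Submodule.zero_mem _
  · rw [if_pos h.le, if_neg (by omega), sub_zero]
    exact Submodule.subset_span ⟨γ, h, rfl⟩
  · rw [if_neg (by omega), if_neg (by omega), sub_self, map_zero]
    exact Submodule.zero_mem _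

theorem ProjBound.norm_projL1_le [Nonempty Γ] (hP : D.ProjBound M) (n : ℕ)
    (x : lp (fun _ : Γ => ℝ) 1) : ‖hP.projL1 n x‖ ≤ M * ‖x‖ :=
  ContinuousLinearMap.le_of_opNorm_le _ (norm_l1Lift_le _ hP.nonneg _) x

theorem ProjBound.tendsto_projL1 [Nonempty Γ] (hP : D.ProjBound M) (x : lp (fun _ : Γ => ℝ) 1) :
    Tendsto (fun n => hP.projL1 n x) atTop (𝓝 x) := by
  refine tendsto_id_of_mem_topologicalClosure hP.norm_projL1_le ?_ (mem_closure_range_toL1ₗ x)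
  rintro _ ⟨b, rfl⟩
  refine tendsto_const_nhds.congr' ?_
  filter_upwards [eventually_ge_atTop (b.support.sup D.rk)] with n hn
  rw [toL1ₗ_apply, projL1_toL1, D.projStar_of_support_le fun η hη => (Finset.le_sup hη).trans hn]

theorem ProjBound.isFDD_Fstar [Nonempty Γ] (hP : D.ProjBound M) :
    IsFDD fun n => D.Fstar (n + 1) :=
  isFDD_of_projections (fun _ => finiteDimensional_Fstar _) hP.projL1_zero hP.projL1_of_mem_lt
    hP.projL1_of_mem_le hP.projL1_sub_mem hP.tendsto_projL1

theorem ProjBound.decompositionConstantLE_Fstar [Nonempty Γ] (hP : D.ProjBound M) :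
    DecompositionConstantLE (fun n => D.Fstar (n + 1)) M :=
  decompositionConstantLE_of_projections hP.projL1_of_mem_lt hP.projL1_of_mem_le hP.norm_projL1_le

/-! ### The pairing and the extension operators -/

theorem pairing_eq_linearCombination (b : Γ →₀ ℝ) (x : Γ → ℝ) :
    pairing b x = Finsupp.linearCombination ℝ x b := rfl

theorem pairing_single (γ : Γ) (r : ℝ) (x : Γ → ℝ) :
    pairing (Finsupp.single γ r) x = r * x γ := by
  simp [pairing]

theorem pairing_sub (b : Γ →₀ ℝ) (x y : Γ → ℝ) :
    pairing b (x - y) = pairing b x - pairing b y := by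
  simp [pairing, Finsupp.sum, mul_sub, Finset.sum_sub_distrib]

theorem pairing_eq_zero {b : Γ →₀ ℝ} {x : Γ → ℝ} (h : ∀ γ ∈ b.support, x γ = 0) :
    pairing b x = 0 :=
  Finset.sum_eq_zero fun γ hγ => by simp [h γ hγ]

theorem abs_pairing_le {C : ℝ} {x : Γ → ℝ} (hx : ∀ γ, |x γ| ≤ C) (b : Γ →₀ ℝ) :
    |pairing b x| ≤ l1norm b * C := by
  rw [pairing, l1norm, Finsupp.sum, Finsupp.sum, Finset.sum_mul]
  refine (Finset.abs_sum_le_sum_abs _ _).trans (Finset.sum_le_sum fun γ _ => ?_)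
  rw [abs_mul]
  exact mul_le_mul_of_nonneg_left (hx γ) (abs_nonneg _)

variable (D)

/-- This adjointness carries the algebra of the projections `P*` over to the operators `J`. -/
theorem pairing_J (b : Γ →₀ ℝ) (m : ℕ) (x : Γ → ℝ) :
    pairing b (D.J m x) = pairing (D.projStar (Set.Iic m) b) x := by
  have : Finsupp.linearCombination ℝ (D.J m x) =
      (Finsupp.linearCombination ℝ x).comp (D.projStar (Set.Iic m)) := by
    ext γ
    simp [J, pairing_eq_linearCombination]
  exact LinearMap.congr_fun this b

theorem J_J (m n : ℕ) (x : Γ → ℝ) : D.J m (D.J n x) = D.J (min m n) x := by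
  funext γ
  rw [J, pairing_J, projStar_projStar, Set.Iic_inter_Iic, min_comm]
  rfl

theorem J_apply_of_le {m : ℕ} {γ : Γ} (h : D.rk γ ≤ m) (x : Γ → ℝ) : D.J m x γ = x γ := by
  rw [J, D.projStar_single_of_le h, pairing_single, one_mul]

theorem J_zero (x : Γ → ℝ) : D.J 0 x = 0 := by
  funext γ
  rw [J, projStar_Iic_zero]
  simp [pairing]

theorem J_add (m : ℕ) (x y : Γ → ℝ) : D.J m (x + y) = D.J m x + D.J m y := by
  funext γ
  exact pairing_add _ _ _

theorem J_sub (m : ℕ) (x y : Γ → ℝ) : D.J m (x - y) = D.J m x - D.J m y := by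
  funext γ
  exact pairing_sub _ _ _

theorem J_smul (m : ℕ) (r : ℝ) (x : Γ → ℝ) : D.J m (r • x) = r • D.J m x := by
  funext γ
  exact pairing_smul _ _ _

variable {D}

theorem ProjBound.abs_J_le (hP : D.ProjBound M) {C : ℝ} {x : Γ → ℝ} (hx : ∀ γ, |x γ| ≤ C) (m : ℕ)
    (γ : Γ) : |D.J m x γ| ≤ M * C :=
  (abs_pairing_le hx _).trans (mul_le_mul_of_nonneg_right (hP γ m) ((abs_nonneg _).trans (hx γ)))

theorem abs_apply_le_norm (y : lp (fun _ : Γ => ℝ) ∞) (γ : Γ) : |y γ| ≤ ‖y‖ :=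
  lp.norm_apply_le_norm ENNReal.top_ne_zero y γ

/-- The operator `Jₘ Rₘ` on `ℓ_∞(Γ)`. -/
noncomputable def ProjBound.extendOp [Nonempty Γ] (hP : D.ProjBound M) (m : ℕ) :
    lp (fun _ : Γ => ℝ) ∞ →L[ℝ] lp (fun _ : Γ => ℝ) ∞ :=
  LinearMap.mkContinuous
    { toFun := fun y => ⟨D.J m y, memℓp_infty ⟨M * ‖y‖, by
        rintro _ ⟨γ, rfl⟩
        exact hP.abs_J_le (abs_apply_le_norm y) m γ⟩⟩
      map_add' := fun y z => Subtype.ext (D.J_add m y z)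
      map_smul' := fun r y => Subtype.ext (D.J_smul m r y) } M fun y =>
    lp.norm_le_of_forall_le (mul_nonneg hP.nonneg (norm_nonneg _)) fun γ =>
      hP.abs_J_le (abs_apply_le_norm y) m γ

theorem ProjBound.coe_extendOp [Nonempty Γ] (hP : D.ProjBound M) (m : ℕ)
    (y : lp (fun _ : Γ => ℝ) ∞) : (hP.extendOp m y : Γ → ℝ) = D.J m y := rfl

theorem ProjBound.norm_extendOp_le [Nonempty Γ] (hP : D.ProjBound M) (m : ℕ)
    (y : lp (fun _ : Γ => ℝ) ∞) : ‖hP.extendOp m y‖ ≤ M * ‖y‖ :=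
  ContinuousLinearMap.le_of_opNorm_le _ (LinearMap.mkContinuous_norm_le _ hP.nonneg _) y

theorem ProjBound.extendOp_mem_Y [Nonempty Γ] (hP : D.ProjBound M) (m : ℕ)
    (y : lp (fun _ : Γ => ℝ) ∞) : hP.extendOp m y ∈ D.Y :=
  Submodule.le_topologicalClosure _ (Submodule.mem_iSup_of_mem m ⟨y, fun _ => rfl⟩)

/-- The projection `Jₘ Rₘ` of `Y`. -/
noncomputable def ProjBound.projY [Nonempty Γ] (hP : D.ProjBound M) (m : ℕ) : D.Y →L[ℝ] D.Y :=
  ((hP.extendOp m).comp D.Y.subtypeL).codRestrict D.Y fun y => hP.extendOp_mem_Y m y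

theorem ProjBound.coe_projY [Nonempty Γ] (hP : D.ProjBound M) (m : ℕ) (y : D.Y) :
    ((hP.projY m y).1 : Γ → ℝ) = D.J m y.1 := rfl

theorem ProjBound.norm_projY_le [Nonempty Γ] (hP : D.ProjBound M) (m : ℕ) (y : D.Y) :
    ‖hP.projY m y‖ ≤ M * ‖y‖ :=
  hP.norm_extendOp_le m y

theorem Y_ext {y z : D.Y} (h : (y.1 : Γ → ℝ) = z.1) : y = z := Subtype.ext (lp.ext h)

theorem ProjBound.tendsto_projY [Nonempty Γ] (hP : D.ProjBound M) (y : D.Y) :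
    Tendsto (fun n => hP.projY n y) atTop (𝓝 y) := by
  rw [tendsto_subtype_rng]
  refine tendsto_id_of_mem_topologicalClosure hP.norm_extendOp_le (fun x hx => ?_) y.2
  refine Submodule.iSup_induction _
    (motive := fun x => Tendsto (fun n => hP.extendOp n x) atTop (𝓝 x)) hx ?_ ?_ ?_
  · rintro m x ⟨x', hx'⟩
    refine tendsto_const_nhds.congr' ?_
    filter_upwards [eventually_ge_atTop m] with n hn
    refine lp.ext ?_
    have h : (x : Γ → ℝ) = D.J m x' := funext hx'
    rw [coe_extendOp, h, J_J, min_eq_right hn]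
  · simp
  · intro x z hx hz
    simpa using hx.add hz

theorem ProjBound.projY_of_mem_F [Nonempty Γ] (hP : D.ProjBound M) {i : ℕ} {z : D.Y}
    (hz : z ∈ D.F (i + 1)) (n : ℕ) : ∃ y : D.Y, (z.1 : Γ → ℝ) = D.J (i + 1) y.1 - D.J i y.1 ∧
      ((hP.projY n z).1 : Γ → ℝ) = D.J (min n (i + 1)) y.1 - D.J (min n i) y.1 := by
  obtain ⟨y, hy⟩ := hz
  have h : (z.1 : Γ → ℝ) = D.J (i + 1) y.1 - D.J i y.1 := funext hy
  exact ⟨y, h, by rw [coe_projY, h, J_sub, J_J, J_J]⟩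

theorem ProjBound.projY_of_mem_lt [Nonempty Γ] (hP : D.ProjBound M) (i n : ℕ) (z : D.Y)
    (hz : z ∈ D.F (i + 1)) (h : i < n) : hP.projY n z = z := by
  obtain ⟨y, h1, h2⟩ := hP.projY_of_mem_F hz n
  refine Y_ext ?_
  rw [h2, h1, min_eq_right h, min_eq_right h.le]

theorem ProjBound.projY_of_mem_le [Nonempty Γ] (hP : D.ProjBound M) (i n : ℕ) (z : D.Y)
    (hz : z ∈ D.F (i + 1)) (h : n ≤ i) : hP.projY n z = 0 := by
  obtain ⟨y, -, h2⟩ := hP.projY_of_mem_F hz n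
  refine Y_ext ?_
  rw [h2, min_eq_left h, min_eq_left (h.trans i.le_succ), sub_self]
  rfl

theorem ProjBound.projY_sub_mem [Nonempty Γ] (hP : D.ProjBound M) (i : ℕ) (y : D.Y) :
    hP.projY (i + 1) y - hP.projY i y ∈ D.F (i + 1) :=
  ⟨y, fun _ => rfl⟩

theorem ProjBound.projY_congr [Nonempty Γ] (hP : D.ProjBound M) {n : ℕ} {y z : D.Y}
    (h : ∀ γ, D.rk γ ≤ n → y.1 γ = z.1 γ) : hP.projY n y = hP.projY n z :=
  Y_ext (D.J_congr h)

theorem ProjBound.finiteDimensional_F [Nonempty Γ] (hP : D.ProjBound M) (i : ℕ) :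
    FiniteDimensional ℝ (D.F (i + 1)) := by
  have := (D.finite_rk_le (i + 1)).to_subtype
  let T : D.F (i + 1) →ₗ[ℝ] ({γ | D.rk γ ≤ i + 1} → ℝ) :=
    { toFun := fun z γ => z.1.1 γ.1
      map_add' := fun _ _ => rfl
      map_smul' := fun _ _ => rfl }
  -- An element of `F_{i+1}` is fixed by `J_{i+1} R_{i+1}`, so its values on the finite set
  -- `Γ_{i+1}` determine it.
  refine FiniteDimensional.of_injective T fun z w h => Subtype.ext ?_
  rw [← hP.projY_of_mem_lt i (i + 1) z.1 z.2 i.lt_succ_self,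
    ← hP.projY_of_mem_lt i (i + 1) w.1 w.2 i.lt_succ_self]
  exact hP.projY_congr fun γ hγ => congrFun h ⟨γ, hγ⟩

theorem ProjBound.isFDD_F [Nonempty Γ] (hP : D.ProjBound M) : IsFDD fun n => D.F (n + 1) := by
  refine isFDD_of_projections hP.finiteDimensional_F ?_ hP.projY_of_mem_lt hP.projY_of_mem_le
    hP.projY_sub_mem hP.tendsto_projY
  ext y : 1
  exact Y_ext (D.J_zero _)

end BourgainDelbaenSets

/-! ### General facts on dual spaces -/

theorem nonempty_dual_equiv_of_antilipschitz {E V : Type*} [NormedAddCommGroup E] [NormedSpace ℝ E]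
    [CompleteSpace E] [NormedAddCommGroup V] [NormedSpace ℝ V] (T : E →L[ℝ] StrongDual ℝ V)
    {K : NNReal} (hT : AntilipschitzWith K T) (hsurj : Function.Surjective T) :
    Nonempty (StrongDual ℝ V ≃L[ℝ] E) :=
  ⟨(ContinuousLinearEquiv.ofBijective T (LinearMap.ker_eq_bot.2 hT.injective)
    (LinearMap.range_eq_top.2 hsurj)).symm⟩

theorem exists_norm_le_one_half_norm_le {E : Type*} [NormedAddCommGroup E] [NormedSpace ℝ E]
    (T : StrongDual ℝ E) : ∃ x, ‖x‖ ≤ 1 ∧ ‖T‖ ≤ 2 * |T x| := by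
  rcases (norm_nonneg T).eq_or_lt with h | h
  · exact ⟨0, by simp, by simp [← h]⟩
  · obtain ⟨x, hx, hx'⟩ := T.exists_lt_apply_of_lt_opNorm (half_lt_self h)
    rw [Real.norm_eq_abs] at hx'
    exact ⟨x, hx.le, by linarith⟩

namespace BourgainDelbaenSets

variable {Γ : Type u} {D : BourgainDelbaenSets Γ} {M : ℝ}

section Dual

/-- A shortcut for unification problems with norms of functionals on `Y`. -/
noncomputable local instance : NormedAddCommGroup (StrongDual ℝ D.Y) := inferInstance

/-- A shortcut for unification problems with norms of functionals on `Y`. -/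
noncomputable local instance : SeminormedAddGroup (StrongDual ℝ D.Y) := inferInstance

/-! ### Functionals on `Y` given by finitely supported vectors -/

theorem norm_Y_le {C : ℝ} (hC : 0 ≤ C) {y : D.Y} (h : ∀ γ, |y.1 γ| ≤ C) : ‖y‖ ≤ C :=
  lp.norm_le_of_forall_le hC h

variable (D) in
/-- The functional on `Y` given by the pairing with `u`. -/
noncomputable def pairY (u : Γ →₀ ℝ) : StrongDual ℝ D.Y :=
  LinearMap.mkContinuous
    { toFun := fun y => pairing u y.1
      map_add' := fun y z => pairing_add u y.1 z.1
      map_smul' := fun r y => pairing_smul u r y.1 } (l1norm u) fun y =>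
    abs_pairing_le (abs_apply_le_norm y.1) u

theorem pairY_apply (u : Γ →₀ ℝ) (y : D.Y) : D.pairY u y = pairing u y.1 := rfl

theorem pairY_single_apply (γ : Γ) (y : D.Y) : D.pairY (Finsupp.single γ 1) y = y.1 γ := by
  rw [pairY_apply, pairing_single, one_mul]

theorem norm_pairY_le (u : Γ →₀ ℝ) : ‖D.pairY u‖ ≤ l1norm u :=
  LinearMap.mkContinuous_norm_le _ (l1norm_nonneg u) _

theorem norm_pairY_single_le (γ : Γ) : ‖D.pairY (Finsupp.single γ 1)‖ ≤ 1 :=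
  (norm_pairY_le _).trans (by rw [l1norm_single, abs_one])

/-- Test `u` on `Jₘ (sign u)` with `m` beyond the support of `u`: this element of `Y` has norm at
most `M` and agrees with `sign u` on the support. -/
theorem ProjBound.l1norm_le [Nonempty Γ] (hP : D.ProjBound M) (u : Γ →₀ ℝ) :
    l1norm u ≤ M * ‖D.pairY u‖ := by
  have hsign : ∀ γ, |(SignType.sign (u γ) : ℝ)| ≤ 1 := fun γ => by
    rcases lt_trichotomy (u γ) 0 with h | h | h <;> simp [h]
  let x : lp (fun _ : Γ => ℝ) ∞ := ⟨fun γ => (SignType.sign (u γ) : ℝ), memℓp_infty ⟨1, by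
    rintro _ ⟨γ, rfl⟩
    exact hsign γ⟩⟩
  have hx : ‖x‖ ≤ 1 := lp.norm_le_of_forall_le zero_le_one hsign
  let m := u.support.sup D.rk
  let y : D.Y := ⟨hP.extendOp m x, hP.extendOp_mem_Y m x⟩
  have hy : ‖y‖ ≤ M := (hP.norm_extendOp_le m x).trans (mul_le_of_le_one_right hP.nonneg hx)
  have h : D.pairY u y = l1norm u := by
    change pairing u (D.J m x) = _
    rw [pairing_J, D.projStar_of_support_le fun η hη => Finset.le_sup hη]
    exact Finset.sum_congr rfl fun γ _ => self_mul_sign (u γ)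
  calc l1norm u = ‖D.pairY u y‖ := by rw [h, Real.norm_eq_abs, abs_of_nonneg (l1norm_nonneg u)]
    _ ≤ ‖D.pairY u‖ * ‖y‖ := (D.pairY u).le_opNorm y
    _ ≤ ‖D.pairY u‖ * M := mul_le_mul_of_nonneg_left hy (norm_nonneg _)
    _ = M * ‖D.pairY u‖ := mul_comm _ _

/-! ### Weak-star limits of the unit vectors -/

variable (D) in
/-- The unit vector `e*_γ` as an element of the dual of `Y` with its weak-star topology. -/
noncomputable def weakUnit (γ : Γ) : WeakDual ℝ D.Y :=
  StrongDual.toWeakDual (D.pairY (Finsupp.single γ 1))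

theorem weakUnit_apply (γ : Γ) (y : D.Y) : D.weakUnit γ y = y.1 γ := pairY_single_apply γ y

theorem exists_ultrafilter_of_mem_closure {g : WeakDual ℝ D.Y}
    (hg : g ∈ closure (Set.range D.weakUnit)) :
    ∃ U : Ultrafilter Γ, ∀ y : D.Y, Tendsto (fun γ => y.1 γ) U (𝓝 (g y)) := by
  have : (comap D.weakUnit (𝓝 g)).NeBot := comap_neBot_iff.2 fun t ht => by
    obtain ⟨_, h1, γ, rfl⟩ := mem_closure_iff_nhds.1 hg t ht
    exact ⟨γ, h1⟩
  refine ⟨Ultrafilter.of (comap D.weakUnit (𝓝 g)), fun y => ?_⟩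
  have h1 : Tendsto D.weakUnit (Ultrafilter.of (comap D.weakUnit (𝓝 g))) (𝓝 g) :=
    tendsto_comap.mono_left (Ultrafilter.of_le _)
  simpa only [Function.comp_def, weakUnit_apply] using
    ((WeakDual.eval_continuous y).tendsto g).comp h1

/-- Along an ultrafilter, the cut sets stabilize to a finite set. -/
theorem exists_last_cut (hC : ¬ HasInfiniteIncreasingChain D.cutFamily) (U : Ultrafilter Γ) :
    ∃ p, (p = 0 ∨ ∀ᶠ γ in U, p ∈ D.cuts γ) ∧ ∀ n, ∀ᶠ γ in U, ∀ q ∈ D.cuts γ, q ≤ n → q ≤ p := by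
  let A : Set ℕ := {q | ∀ᶠ γ in U, q ∈ D.cuts γ}
  have hA : ∀ n, ∀ᶠ γ in U, ∀ q ∈ Set.Iic n, q ∈ D.cuts γ ↔ q ∈ A := fun n => by
    refine (eventually_all_finite (Set.finite_Iic n)).2 fun q _ => ?_
    by_cases h : q ∈ A
    · filter_upwards [show ∀ᶠ γ in U, q ∈ D.cuts γ from h] with γ hγ
      simp [hγ, h]
    · filter_upwards [Ultrafilter.eventually_not.2 h] with γ hγ
      simp [hγ, h]
  -- Each initial segment of `A` is realized by the cuts of some `γ`, so an infinite `A` would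
  -- produce a chain.
  have hfin : A.Finite := by
    by_contra hinf
    exact hC (D.hasInfiniteIncreasingChain_of_infinite hinf fun n => (hA n).exists)
  have hmax : ∃ p, (p = 0 ∨ p ∈ A) ∧ ∀ q ∈ A, q ≤ p := by
    rcases A.eq_empty_or_nonempty with h | h
    · exact ⟨0, Or.inl rfl, by simp [h]⟩
    · obtain ⟨p, hp, hp'⟩ := Set.exists_max_image A id hfin h
      exact ⟨p, Or.inr hp, hp'⟩
  obtain ⟨p, hp, hp'⟩ := hmax
  refine ⟨p, hp, fun n => ?_⟩
  filter_upwards [hA n] with γ hγ q hq hqn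
  exact hp' q ((hγ q hqn).1 hq)

/-- The form of `exists_next_cut` for elements of `Y` vanishing up to the cut `p`. -/
theorem WeightCondition.exists_next_cut_pairing {θ : ℝ} (hD : D.WeightCondition θ) (hθ : 0 ≤ θ)
    (p : ℕ) (γ : Γ) (hp : (p = 0 ∨ p ∈ D.cuts γ) ∧ p < D.rk γ) :
    ∃ q u, (q ∈ D.cuts γ ∧ p < q) ∧
      (l1norm u ≤ θ ∨ ∃ τ η, 0 ≤ τ ∧ τ ≤ 1 ∧ D.c η = 0 ∧ u = Finsupp.single η τ) ∧
      ∀ n, p ≤ n → n < q → ∀ y : Γ → ℝ, (∀ η, D.rk η ≤ p → y η = 0) →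
        D.J n y γ = pairing u (D.J n y) := by
  obtain ⟨q, hq, hpq, v, u, hv, hu, h⟩ := hD.exists_next_cut hθ p γ hp.1 hp.2
  refine ⟨q, u, ⟨hq, hpq⟩, hu, fun n hn1 hn2 y hy => ?_⟩
  have hv0 : pairing v y = 0 := pairing_eq_zero fun η hη => hy η (hv η hη)
  have hp0 : pairing (D.projStar (Set.Iic p) u) y = 0 := by
    rw [← pairing_J, D.J_congr (y := 0) hy]
    simp [pairing, J]
  rw [pairing_J, J, h n hn1 hn2]
  simp only [pairing_eq_linearCombination, map_add, map_sub] at *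
  rw [hv0, hp0]
  ring

/-- Approximate `y` in norm by some `J n y` with `n ≥ p`. Both functionals have norm at most 1, and
they coincide on `J n y` once `q γ` exceeds `n`. -/
theorem tendsto_tail_pairing [Nonempty Γ] (hP : D.ProjBound M) {U : Ultrafilter Γ} {q : Γ → ℕ}
    {u : Γ → Γ →₀ ℝ} {p : ℕ} {y : D.Y} (hu : ∀ᶠ γ in U, l1norm (u γ) ≤ 1)
    (hq : ∀ n, ∀ᶠ γ in U, n < q γ)
    (h : ∀ᶠ γ in U, ∀ n, p ≤ n → n < q γ → D.J n y.1 γ = pairing (u γ) (D.J n y.1)) :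
    Tendsto (fun γ => y.1 γ - D.pairY (u γ) y) U (𝓝 0) := by
  rw [Metric.tendsto_nhds]
  intro ε hε
  obtain ⟨n₀, hn₀⟩ := Metric.tendsto_atTop.1 (hP.tendsto_projY y) (ε / 2) (by linarith)
  have hn := hn₀ (max n₀ p) (le_max_left _ _)
  rw [dist_comm, dist_eq_norm] at hn
  filter_upwards [hu, hq (max n₀ p), h] with γ h1 h2 h3
  have h4 := h3 _ (le_max_right n₀ p) h2
  set n := max n₀ p
  have h5 : y.1 γ - D.pairY (u γ) y =
      (y - hP.projY n y).1 γ - D.pairY (u γ) (y - hP.projY n y) := by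
    rw [map_sub]
    change _ = (y.1 γ - D.J n y.1 γ) - (_ - pairing (u γ) (D.J n y.1))
    rw [h4]
    ring
  have h6 := abs_apply_le_norm (y - hP.projY n y).1 γ
  have h7 := (D.pairY (u γ)).le_of_opNorm_le ((norm_pairY_le (u γ)).trans h1) (y - hP.projY n y)
  rw [Real.norm_eq_abs, one_mul] at h7
  rw [Real.dist_eq, sub_zero, h5]
  refine (abs_sub _ _).trans_lt ?_
  change _ + _ < ε
  change |_| ≤ ‖y - hP.projY n y‖ at h6
  linarith

/-- The value at `η` of an element of `Y` is small if `c*_η = 0` and `η` has large rank. -/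
theorem abs_apply_le_of_c_eq_zero [Nonempty Γ] (hP : D.ProjBound M) {n : ℕ} {η : Γ}
    (hη : D.c η = 0) (hn : n < D.rk η) (y : D.Y) : |y.1 η| ≤ ‖y - hP.projY n y‖ := by
  have h1 : D.J n y.1 η = 0 := by
    rw [J, D.projStar_single_of_lt hn, hη, map_zero]
    simp [pairing]
  have h2 : (y - hP.projY n y).1 η = y.1 η - D.J n y.1 η := rfl
  rw [h1, sub_zero] at h2
  rw [← h2]
  exact abs_apply_le_norm _ _

/-- A weak-star limit of unit vectors agrees on tails with a functional of norm at most `θ`. -/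
theorem exists_small_of_mem_closure [Nonempty Γ] {θ : ℝ} (hD : D.WeightCondition θ) (hθ : 0 ≤ θ)
    (hθ1 : θ ≤ 1) (hP : D.ProjBound M) (hC : ¬ HasInfiniteIncreasingChain D.cutFamily)
    {g : WeakDual ℝ D.Y} (hg : g ∈ closure (Set.range D.weakUnit)) :
    ∃ h : StrongDual ℝ D.Y, ‖h‖ ≤ θ ∧
      ∃ N, ∀ y : D.Y, (∀ γ, D.rk γ ≤ N → y.1 γ = 0) → g y = h y := by
  have hzero : (∃ N, ∀ y : D.Y, (∀ γ, D.rk γ ≤ N → y.1 γ = 0) → g y = 0) →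
      ∃ h : StrongDual ℝ D.Y, ‖h‖ ≤ θ ∧
        ∃ N, ∀ y : D.Y, (∀ γ, D.rk γ ≤ N → y.1 γ = 0) → g y = h y :=
    fun ⟨N, h⟩ => ⟨0, by simpa using hθ, N, h⟩
  obtain ⟨U, hU⟩ := exists_ultrafilter_of_mem_closure hg
  obtain ⟨p, hp, hcuts⟩ := exists_last_cut hC U
  -- Otherwise the ranks are at most `p` along `U`, and the limit vanishes on tails.
  by_cases hr : ∀ᶠ γ in U, p < D.rk γ
  swap
  · refine hzero ⟨p, fun y hy => tendsto_nhds_unique (hU y) (tendsto_const_nhds.congr' ?_)⟩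
    filter_upwards [Ultrafilter.eventually_not.2 hr] with γ hγ
    exact (hy γ (not_lt.1 hγ)).symm
  have hS : ∀ᶠ γ in U, (p = 0 ∨ p ∈ D.cuts γ) ∧ p < D.rk γ := by
    refine Eventually.and ?_ hr
    rcases hp with hp | hp
    · exact Eventually.of_forall fun _ => Or.inl hp
    · exact hp.mono fun _ => Or.inr
  choose! q u hq hu hJ using fun γ => hD.exists_next_cut_pairing hθ p γ
  -- `q γ` is a cut beyond `p`, while cuts up to `n` are eventually at most `p`.
  have hqlim : ∀ n, ∀ᶠ γ in U, n < q γ := fun n => by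
    filter_upwards [hS, hcuts n] with γ h1 h2
    by_contra h3
    exact absurd (h2 _ (hq γ h1).1 (not_lt.1 h3)) (not_le.2 (hq γ h1).2)
  have hu1 : ∀ᶠ γ in U, l1norm (u γ) ≤ 1 := by
    filter_upwards [hS] with γ h1
    rcases hu γ h1 with h | ⟨τ, η, h0, h1, -, h⟩
    · exact h.trans hθ1
    · rwa [h, l1norm_single, abs_of_nonneg h0]
  have hlim : ∀ y : D.Y, (∀ γ, D.rk γ ≤ p → y.1 γ = 0) →
      Tendsto (fun γ => D.pairY (u γ) y) U (𝓝 (g y)) := fun y hy => by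
    have h1 := tendsto_tail_pairing hP (y := y) (p := p) hu1 hqlim
      (hS.mono fun γ hγ n h1 h2 => hJ γ hγ n h1 h2 y.1 hy)
    simpa using (hU y).sub h1
  -- In the small case, weak-star compactness of the ball of radius `θ` provides `h`. Otherwise `u
  -- γ` is a multiple of some `e*_η = d*_η` along `U`, and the limit is 0 on tails.
  by_cases hsmall : ∀ᶠ γ in U, l1norm (u γ) ≤ θ
  · obtain ⟨h, hK, hh⟩ := (WeakDual.isCompact_closedBall (0 : StrongDual ℝ D.Y) θ).ultrafilter_le_nhds'
      (U.map fun γ => StrongDual.toWeakDual (D.pairY (u γ))) (by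
        refine Ultrafilter.mem_map.2 ?_
        filter_upwards [hsmall] with γ hγ
        rw [Set.mem_preimage, Set.mem_preimage, mem_closedBall_zero_iff]
        exact (norm_pairY_le (u γ)).trans hγ)
    refine ⟨WeakDual.toStrongDual h, mem_closedBall_zero_iff.1 hK, p, fun y hy => ?_⟩
    have h1 : Tendsto (fun γ => StrongDual.toWeakDual (D.pairY (u γ))) U (𝓝 h) := hh
    exact tendsto_nhds_unique (hlim y hy) (((WeakDual.eval_continuous y).tendsto h).comp h1)
  have hS' : ∀ᶠ γ in U, ∃ τ η, 0 ≤ τ ∧ τ ≤ 1 ∧ D.c η = 0 ∧ u γ = Finsupp.single η τ := by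
    filter_upwards [hS, Ultrafilter.eventually_not.2 hsmall] with γ h1 h2
    exact (hu γ h1).resolve_left h2
  choose! τ η hτ0 hτ1 hη huη using
    fun γ (h : ∃ τ η, 0 ≤ τ ∧ τ ≤ 1 ∧ D.c η = 0 ∧ u γ = Finsupp.single η τ) => h
  have hval : ∀ᶠ γ in U, ∀ y : D.Y, |D.pairY (u γ) y| ≤ |y.1 (η γ)| := by
    filter_upwards [hS'] with γ hγ y
    rw [huη γ hγ, pairY_apply, pairing_single, abs_mul, abs_of_nonneg (hτ0 γ hγ)]
    exact mul_le_of_le_one_left (abs_nonneg _) (hτ1 γ hγ)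
  refine hzero ?_
  -- If the ranks of `η γ` are bounded, `y` vanishes there for far enough tails. If not, they exceed
  -- every `n` along `U`, and `|y (η γ)| ≤ ‖y - Pₙ y‖`.
  by_cases hb : ∃ N, ∀ᶠ γ in U, D.rk (η γ) ≤ N
  · obtain ⟨N, hN⟩ := hb
    refine ⟨max N p, fun y hy => tendsto_nhds_unique
      (hlim y fun γ hγ => hy γ (hγ.trans (le_max_right _ _))) (tendsto_const_nhds.congr' ?_)⟩
    filter_upwards [hval, hN] with γ h1 h2
    have := h1 y
    rw [hy _ (h2.trans (le_max_left _ _)), abs_zero] at this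
    exact (abs_nonpos_iff.1 this).symm
  · push Not at hb
    refine ⟨p, fun y hy => tendsto_nhds_unique (hlim y hy) ?_⟩
    rw [Metric.tendsto_nhds]
    intro ε hε
    obtain ⟨n, hn⟩ := Metric.tendsto_atTop.1 (hP.tendsto_projY y) ε hε
    have hn := hn n le_rfl
    rw [dist_comm, dist_eq_norm] at hn
    filter_upwards [hval, hS', hb n] with γ h1 h2 h3
    rw [Real.dist_eq, sub_zero]
    exact ((h1 y).trans (abs_apply_le_of_c_eq_zero hP (hη γ h2) h3 y)).trans_lt hn

/-! ### Shrinking -/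

/-- The contraction step. At a point of `K` the tails are seen through a functional of norm at most
`θ`, to which the assumed bound `a` applies; integration over `K` then reaches every `f`. -/
theorem eventually_abs_le_improve [Nonempty Γ] {θ : ℝ} (hD : D.WeightCondition θ) (hθ : 0 ≤ θ)
    (hθ1 : θ ≤ 1) (hP : D.ProjBound M) (hC : ¬ HasInfiniteIncreasingChain D.cutFamily)
    {z : ℕ → D.Y} {B a : ℝ} (hB : ∀ n, ‖z n‖ ≤ B) (hz : ∀ n γ, D.rk γ ≤ n → (z n).1 γ = 0)
    (ha : 0 ≤ a) (h : ∀ f : StrongDual ℝ D.Y, ∀ ε > 0, ∀ᶠ n in atTop, |f (z n)| ≤ a * ‖f‖ + ε)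
    (f : StrongDual ℝ D.Y) : ∀ ε > 0, ∀ᶠ n in atTop, |f (z n)| ≤ θ * a * ‖f‖ + ε := by
  let K : Set (WeakDual ℝ D.Y) := closure (Set.range D.weakUnit)
  have hK : IsCompact K := by
    refine (WeakDual.isCompact_closedBall (0 : StrongDual ℝ D.Y) 1).of_isClosed_subset
      isClosed_closure (closure_minimal ?_ (WeakDual.isClosed_closedBall 0 1))
    rintro _ ⟨γ, rfl⟩
    exact mem_closedBall_zero_iff.2 (norm_pairY_single_le γ)
  have : CompactSpace K := isCompact_iff_compactSpace.1 hK
  have hmem : ∀ γ, D.weakUnit γ ∈ K := fun γ => subset_closure ⟨γ, rfl⟩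
  have : Nonempty K := (inferInstance : Nonempty Γ).map fun γ => ⟨_, hmem γ⟩
  let Φ : D.Y →ₗ[ℝ] C(K, ℝ) :=
    { toFun := fun y => ⟨fun g => g.1 y, (WeakDual.eval_continuous y).comp continuous_subtype_val⟩
      map_add' := fun y y' => by
        ext g
        exact map_add g.1 y y'
      map_smul' := fun r y => by
        ext g
        exact map_smul g.1 r y }
  have hΦ : ∀ y, ‖y‖ ≤ ‖Φ y‖ := fun y => norm_Y_le (norm_nonneg _) fun γ => by
    rw [← weakUnit_apply γ y]
    exact (Φ y).norm_coe_le_norm ⟨_, hmem γ⟩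
  have hΦ' : ∀ y, ‖Φ y‖ ≤ ‖y‖ := fun y => by
    refine (ContinuousMap.norm_le _ (norm_nonneg _)).2 fun g => ?_
    have hg : WeakDual.toStrongDual g.1 ∈ Metric.closedBall (0 : StrongDual ℝ D.Y) 1 := by
      refine closure_minimal (t := WeakDual.toStrongDual ⁻¹' Metric.closedBall 0 1) ?_
        (WeakDual.isClosed_closedBall 0 1) g.2
      rintro _ ⟨γ, rfl⟩
      exact mem_closedBall_zero_iff.2 (norm_pairY_single_le γ)
    have := (WeakDual.toStrongDual g.1).le_of_opNorm_le (mem_closedBall_zero_iff.1 hg) y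
    rwa [one_mul] at this
  refine eventually_abs_le_of_pointwise Φ f.toLinearMap (norm_nonneg f)
    (fun y => (f.le_opNorm y).trans (mul_le_mul_of_nonneg_left (hΦ y) (norm_nonneg f)))
    (fun n => (hΦ' _).trans (hB n)) (mul_nonneg hθ ha) fun g ε hε => ?_
  obtain ⟨k, hk, N, hN⟩ := exists_small_of_mem_closure hD hθ hθ1 hP hC g.2
  filter_upwards [h k ε hε, eventually_ge_atTop N] with n h1 h2
  have h3 : Φ (z n) g = k (z n) := hN (z n) fun γ hγ => hz n γ (hγ.trans h2)
  rw [h3]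
  nlinarith

/-- The trivial bound `B ‖f‖` is improved by a factor `θ < 1` any number of times. -/
theorem tendsto_functional_tails [Nonempty Γ] {θ : ℝ} (hD : D.WeightCondition θ) (hθ : 0 ≤ θ)
    (hθ1 : θ < 1) (hP : D.ProjBound M) (hC : ¬ HasInfiniteIncreasingChain D.cutFamily)
    {z : ℕ → D.Y} {B : ℝ} (hB : ∀ n, ‖z n‖ ≤ B) (hz : ∀ n γ, D.rk γ ≤ n → (z n).1 γ = 0)
    (f : StrongDual ℝ D.Y) : Tendsto (fun n => f (z n)) atTop (𝓝 0) := by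
  have hB0 : 0 ≤ B := (norm_nonneg _).trans (hB 0)
  have key : ∀ j : ℕ, ∀ f : StrongDual ℝ D.Y, ∀ ε > 0, ∀ᶠ n in atTop,
      |f (z n)| ≤ θ ^ j * B * ‖f‖ + ε := by
    intro j
    induction j with
    | zero =>
      refine fun f ε hε => Eventually.of_forall fun n => ?_
      have h1 := f.le_opNorm_of_le (hB n)
      rw [Real.norm_eq_abs] at h1
      linarith
    | succ j ih =>
      intro f ε hε
      have := eventually_abs_le_improve hD hθ hθ1.le hP hC hB hz (by positivity) ih f ε hε
      simpa [pow_succ', mul_assoc] using this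
  rw [Metric.tendsto_nhds]
  intro ε hε
  have h1 : Tendsto (fun j : ℕ => θ ^ j * B * ‖f‖) atTop (𝓝 0) := by
    simpa using ((tendsto_pow_atTop_nhds_zero_of_lt_one hθ hθ1).mul_const B).mul_const ‖f‖
  obtain ⟨j, hj⟩ := (h1.eventually (gt_mem_nhds (half_pos hε))).exists
  filter_upwards [key j f (ε / 4) (by linarith)] with n hn
  rw [Real.dist_eq, sub_zero]
  linarith

/-- Choose `x n` in the unit ball norming `f - f ∘ Pₙ` up to a factor 2. The vectors `x n - Pₙ (x
n)` are bounded tails, and `f` takes on them the value of `f - f ∘ Pₙ` at `x n`. -/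
theorem tendsto_comp_projY [Nonempty Γ] {θ : ℝ} (hD : D.WeightCondition θ) (hθ : 0 ≤ θ)
    (hθ1 : θ < 1) (hP : D.ProjBound M) (hC : ¬ HasInfiniteIncreasingChain D.cutFamily)
    (f : StrongDual ℝ D.Y) : Tendsto (fun n => f.comp (hP.projY n)) atTop (𝓝 f) := by
  choose x hx1 hx using fun n => exists_norm_le_one_half_norm_le (f - f.comp (hP.projY n))
  have hz := tendsto_functional_tails hD hθ hθ1 hP hC (z := fun n => x n - hP.projY n (x n))
    (B := 1 + M) (fun n => (norm_sub_le _ _).trans (add_le_add (hx1 n)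
      ((hP.norm_projY_le n _).trans (mul_le_of_le_one_right hP.nonneg (hx1 n)))))
    (fun n γ hγ => by
      change (x n).1 γ - D.J n (x n).1 γ = 0
      rw [D.J_apply_of_le hγ, sub_self]) f
  rw [tendsto_iff_norm_sub_tendsto_zero]
  refine squeeze_zero (fun _ => norm_nonneg _) (fun n => ?_)
    (by simpa using (hz.abs.const_mul 2))
  rw [norm_sub_rev]
  simpa using hx n

theorem comp_projY_mem [Nonempty Γ] (hP : D.ProjBound M) (f : StrongDual ℝ D.Y) (n : ℕ) :
    f.comp (hP.projY n) ∈ ⨆ i, dualSummand (fun n => D.F (n + 1)) i := by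
  induction n with
  | zero =>
    have : f.comp (hP.projY 0) = 0 := by
      ext y
      have h0 : hP.projY 0 y = 0 := Y_ext (D.J_zero _)
      simp [h0]
    rw [this]
    exact Submodule.zero_mem _
  | succ n ih =>
    have h1 : f.comp (hP.projY (n + 1)) = f.comp (hP.projY n) +
        f.comp (hP.projY (n + 1) - hP.projY n) := by
      ext y
      simp
    rw [h1]
    refine Submodule.add_mem _ ih (Submodule.mem_iSup_of_mem n fun j hj x hx => ?_)
    change f (hP.projY (n + 1) x - hP.projY n x) = 0
    rcases lt_or_gt_of_ne hj with h | h
    · rw [hP.projY_of_mem_lt j _ x hx (by omega), hP.projY_of_mem_lt j _ x hx h, sub_self, map_zero]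
    · rw [hP.projY_of_mem_le j _ x hx (by omega), hP.projY_of_mem_le j _ x hx h.le, sub_self,
        map_zero]

theorem isShrinkingFDD_F [Nonempty Γ] (hP : D.ProjBound M)
    (hlim : ∀ f : StrongDual ℝ D.Y, Tendsto (fun n => f.comp (hP.projY n)) atTop (𝓝 f)) :
    IsShrinkingFDD fun n => D.F (n + 1) :=
  ⟨hP.isFDD_F, eq_top_iff.2 fun f _ =>
    mem_closure_of_tendsto (hlim f) (Eventually.of_forall fun n => comp_projY_mem hP f n)⟩

/-! ### The dual of `Y` -/

theorem nonempty_equiv_nat (D : BourgainDelbaenSets Γ) : Nonempty (ℕ ≃ Γ) := by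
  have hcount : Countable Γ := by
    rw [← Set.countable_univ_iff]
    have : (Set.univ : Set Γ) = ⋃ n, {γ | D.rk γ = n} := by ext; simp
    rw [this]
    exact Set.countable_iUnion fun n => (D.finite_rk n).countable
  have hinf : Infinite Γ := by
    choose g hg using fun n : ℕ => D.exists_rk (n + 2) (by omega)
    refine Infinite.of_injective g fun m n h => ?_
    have h1 := hg m
    rw [h, hg n] at h1
    omega
  obtain ⟨_⟩ := nonempty_denumerable Γ
  exact ⟨(Denumerable.eqv Γ).symm⟩

variable (D) in
/-- The map `ℓ₁ → Y*`, after an enumeration of `Γ`. -/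
noncomputable def toDual (σ : ℕ ≃ Γ) : lp (fun _ : ℕ => ℝ) 1 →L[ℝ] StrongDual ℝ D.Y :=
  l1Lift (fun n => D.pairY (Finsupp.single (σ n) 1)) 1 fun _ => norm_pairY_single_le _

theorem toDual_single (σ : ℕ ≃ Γ) (n : ℕ) (r : ℝ) :
    D.toDual σ (lp.single 1 n r) = r • D.pairY (Finsupp.single (σ n) 1) :=
  l1Lift_single _ _ _ _ _

theorem toDual_toL1 (σ : ℕ ≃ Γ) (b : ℕ →₀ ℝ) :
    D.toDual σ (toL1 b) = D.pairY (b.mapDomain σ) := by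
  let T : (Γ →₀ ℝ) →ₗ[ℝ] StrongDual ℝ D.Y :=
    { toFun := D.pairY
      map_add' := fun u v => by
        ext y
        simp [pairY_apply, pairing_eq_linearCombination]
      map_smul' := fun r v => by
        ext y
        simp [pairY_apply, pairing_eq_linearCombination] }
  have : (D.toDual σ).toLinearMap.comp toL1ₗ = T.comp (Finsupp.lmapDomain ℝ ℝ σ) := by
    ext n : 2
    simp only [LinearMap.comp_apply, Finsupp.lsingle_apply, toL1ₗ_apply,
      ContinuousLinearMap.coe_coe, toL1_single, toDual_single, one_smul,
      Finsupp.lmapDomain_apply, Finsupp.mapDomain_single]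
    rfl
  exact LinearMap.congr_fun this b

theorem norm_le_norm_toDual [Nonempty Γ] (hP : D.ProjBound M) (σ : ℕ ≃ Γ)
    (b : lp (fun _ : ℕ => ℝ) 1) : ‖b‖ ≤ M * ‖D.toDual σ b‖ := by
  have hcl : IsClosed {b | ‖b‖ ≤ M * ‖D.toDual σ b‖} :=
    isClosed_le continuous_norm (continuous_const.mul (D.toDual σ).continuous.norm)
  refine closure_minimal ?_ hcl (mem_closure_range_toL1ₗ b)
  rintro _ ⟨b, rfl⟩
  change ‖toL1 b‖ ≤ M * ‖D.toDual σ (toL1 b)‖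
  rw [toDual_toL1, norm_toL1]
  have hsum : l1norm (b.mapDomain σ) = l1norm b :=
    Finsupp.sum_mapDomain_index_inj (h := fun _ r => |r|) σ.injective
  rw [← hsum]
  exact hP.l1norm_le _

theorem comp_projY_mem_range [Nonempty Γ] (hP : D.ProjBound M) (σ : ℕ ≃ Γ) (f : StrongDual ℝ D.Y)
    (n : ℕ) : f.comp (hP.projY n) ∈ LinearMap.range (D.toDual σ).toLinearMap := by
  have := (D.finite_rk_le n).to_subtype
  let L : {γ | D.rk γ ≤ n} → D.Y →ₗ[ℝ] ℝ := fun γ => (D.pairY (Finsupp.single γ.1 1)).toLinearMap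
  have h1 : (f.comp (hP.projY n)).toLinearMap ∈ Submodule.span ℝ (Set.range L) := by
    -- `Pₙ y` depends only on the values of `y` on the finite set `Γₙ`, so `f ∘ Pₙ` is a combination
    -- of the corresponding evaluations.
    refine mem_span_of_iInf_ker_le_ker fun y hy => ?_
    have hy0 : hP.projY n y = hP.projY n 0 := hP.projY_congr fun γ hγ => by
      have h := (Submodule.mem_iInf _).1 hy ⟨γ, hγ⟩
      exact (pairY_single_apply γ y).symm.trans h
    change f (hP.projY n y) = 0
    rw [hy0, (hP.projY n).map_zero, f.map_zero]
  have h2 : Submodule.span ℝ (Set.range L) ≤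
      (LinearMap.range (D.toDual σ).toLinearMap).map (ContinuousLinearMap.coeLM ℝ) := by
    rw [Submodule.span_le]
    rintro _ ⟨γ, rfl⟩
    refine ⟨_, ⟨lp.single 1 (σ.symm γ.1) 1, rfl⟩, ?_⟩
    change ((D.toDual σ (lp.single 1 (σ.symm γ.1) 1) : StrongDual ℝ D.Y) : D.Y →ₗ[ℝ] ℝ) = _
    rw [toDual_single, one_smul, Equiv.apply_symm_apply]
  obtain ⟨k, hk, hk'⟩ := h2 h1
  rwa [← ContinuousLinearMap.coe_injective hk']

/-- The map from `ℓ₁` is bounded below, so its range is closed; it contains each `f ∘ Pₙ`, hence the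
limit `f`. -/
theorem nonempty_dual_equiv [Nonempty Γ] (hP : D.ProjBound M)
    (hlim : ∀ f : StrongDual ℝ D.Y, Tendsto (fun n => f.comp (hP.projY n)) atTop (𝓝 f)) :
    Nonempty (StrongDual ℝ D.Y ≃L[ℝ] lp (fun _ : ℕ => ℝ) 1) := by
  obtain ⟨σ⟩ := D.nonempty_equiv_nat
  have hanti : AntilipschitzWith M.toNNReal (D.toDual σ) :=
    (D.toDual σ).antilipschitz_of_bound fun b => by
      rw [Real.coe_toNNReal _ hP.nonneg]
      exact norm_le_norm_toDual hP σ b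
  have hclosed := hanti.isClosed_range (D.toDual σ).uniformContinuous
  exact nonempty_dual_equiv_of_antilipschitz (V := D.Y) (D.toDual σ) hanti fun f =>
    hclosed.mem_of_tendsto (hlim f)
      (Eventually.of_forall fun n => comp_projY_mem_range hP σ f n)

end Dual

/-! ### Choice of constants and conclusion -/

theorem nonempty_of_exists_rk (D : BourgainDelbaenSets Γ) : Nonempty Γ :=
  let ⟨γ, _⟩ := D.exists_rk 2 le_rfl
  ⟨γ⟩

theorem WeightCondition.projBound {θ : ℝ} (hD : D.WeightCondition θ) (hθ : θ < 1 / 2) :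
    D.ProjBound (max (1 / (1 - 2 * θ)) 2) := by
  have h0 : 0 < 1 - 2 * θ := by linarith
  set M := max (1 / (1 - 2 * θ)) 2 with hM
  have hM2 : 2 ≤ M := le_max_right _ _
  -- `θ` may be negative, so it is replaced by `max θ 0`. For `θ ≥ 0` the condition `1 + 2θM ≤ M`
  -- says `1 / (1 - 2θ) ≤ M`.
  refine (hD.mono (le_max_left θ 0)).l1norm_projStar_single_le (le_max_right θ 0) hM2 ?_
  rcases le_total θ 0 with h | h
  · rw [max_eq_right h]
    linarith
  · rw [max_eq_left h]
    have h1 : 1 / (1 - 2 * θ) ≤ M := le_max_left _ _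
    rw [div_le_iff₀ h0] at h1
    linarith

end BourgainDelbaenSets

theorem corollary3p8 {Γ : Type u} (D : BourgainDelbaenSets Γ) (θ : ℝ) (hθ : θ < 1 / 2)
    (hD : D.WeightCondition θ) :
    (IsFDD (fun n => D.Fstar (n + 1)) ∧
      DecompositionConstantLE (fun n => D.Fstar (n + 1)) (max (1 / (1 - 2 * θ)) 2)) ∧
    IsFDD (fun n => D.F (n + 1)) ∧
    (IsCompact (closure (FinSubsets.of '' D.cutFamily)) ↔
      ¬ HasInfiniteIncreasingChain D.cutFamily) ∧
    (IsCompact (closure (FinSubsets.of '' D.cutFamily)) →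
      IsShrinkingFDD (fun n => D.F (n + 1)) ∧
      Nonempty (StrongDual ℝ D.Y ≃L[ℝ] lp (fun _ : ℕ => ℝ) 1)) := by
  have := D.nonempty_of_exists_rk
  have hP := hD.projBound hθ
  refine ⟨⟨hP.isFDD_Fstar, hP.decompositionConstantLE_Fstar⟩, hP.isFDD_F,
    D.isCompact_closure_cutFamily_iff, fun hK => ?_⟩
  have hlim := BourgainDelbaenSets.tendsto_comp_projY (hD.mono (le_max_left θ 0))
    (le_max_right θ 0) (max_lt (by linarith) one_pos) hP (D.isCompact_closure_cutFamily_iff.1 hK)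
  exact ⟨BourgainDelbaenSets.isShrinkingFDD_F hP hlim,
    BourgainDelbaenSets.nonempty_dual_equiv hP hlim⟩
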